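/- **Definitions.** All balls are open Euclidean balls. Let $U\subseteq\mathbb R^d$ be open and let $\nu$ be a Radon measure on $U$. * For $D>0$, $\nu$ is *$D$-Federer* on an open set $V$ if $\nu(B(x,r/3))>\nu(B(x,r))/D$ for every ball $B(x,r)\subseteq V$ with $x\in\operatorname{supp}\nu$. * $\nu$ is *absolutely $(\tilde C,\tilde\alpha)$-decaying* on $U$, where $\tilde C,\tilde\alpha>0$, if $\nu(B\cap L^{(\varepsilon)})\le\tilde C(\varepsilon/r)^{\tilde\alpha}\nu(B)$ for every ball $B\subseteq U$ of radius $r$ centred on $\operatorname{supp}\nu$, every affine hyperplane $L\subset\mathbb R^d$ and every $\varepsilon>0$. Here $L^{(\varepsilon)}$ is the $\varepsilon$-neighbourhood of $L$. * For $C,\alpha>0$, a $\nu$-measurable function $g$ is *$(C,\alpha)$-good* on $V$ with respect to $\nu$ if for every ball $B\subseteq V$ centred on $\operatorname{supp}\nu$ and every $\varepsilon>0$ $$\nu\{y\in B:|g(y)|<\varepsilon\}\le C\Bigl(\frac{\varepsilon}{\sup_{B\cap\operatorname{supp}\nu}|g|}\Bigr)^{\alpha}\nu(B),$$ with the conventions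 $\varepsilon/0=\infty$ and $\varepsilon/\infty=0$. **Statement.** Let $d,\tau,k\ge1$ be integers, $U\subseteq\mathbb R^d$ open, and $\mathbf f=(f_0,\dots,f_{\tau-1}):U\to\mathbb R^\tau$ real analytic. Let $N$ be * either the number of partitions $\lambda_0\ge\dots\ge\lambda_{\tau-1}\ge0$ with $\lambda_0+\dots+\lambda_{\tau-1}\le k$, * or, provided that $\tau\ge2$, $k\ge2$ and $(\tau,k)\ne(2,2)$, the number $\binom{k+\tau-1}{\tau}$. Then there is a real analytic function $W$ on $U$, depending only on $\mathbf f$ and $k$ and not identically zero on any connected component of $U$, such that, with $Z_{\mathbf f}=\{x\in U:W(x)=0\}$, the following holds for every $x\in U\setminus Z_{\mathbf f}$. 1. Let $\nu$ be a Radon measure on $U$ that is absolutely $(\tilde C,\tilde\alpha)$-decaying on $U$ for some $\tilde C,\tilde\alpha>0$, and suppose that $x$ has a neighbourhood on which $\nu$ is $D$-Federer for some $D>0$ (this holds for every $x\in U$ if $\nu$ is $D$-Federer on $U$). Then there are an open neighbourhood $V\subseteq U$ of $x$ and a constant $C_x>0$ such that $s(\mathbf f)$ is $(C_x,\alpha)$-good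 on $V$ with respect to $\nu$ for every symmetric polynomial $s\in\mathbb R[T_0,\dots,T_{\tau-1}]$ of degree at most $k$, where $\alpha=\tilde\alpha/(2^N-2)$. 2. If $\nu$ is Lebesgue measure, the same conclusion holds with $\alpha=\dfrac1{d(N-1)}$. 3. If $\nu$ is Lebesgue measure and $\mathbf f$ is the restriction to $U$ of a polynomial map of degree $\deg\mathbf f\ge1$ (the maximum of the total degrees of its components), the same conclusion holds with $\alpha=\dfrac1{k\deg\mathbf f}$. -/

import Mathlib

open Set Metric MeasureTheory
open scoped ENNReal

namespace SymGood

/-- Euclidean space `ℝ^d`. -/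
abbrev E (d : ℕ) : Type := EuclideanSpace ℝ (Fin d)

/-- `ν` is a Radon (that is, locally finite Borel) measure on the open set `U`. Only the values of
`ν` on subsets of `U` matter; a measure on `U` is regarded as a measure on `ℝ^d` through its
extension by zero. -/
def IsRadonOn {d : ℕ} (ν : Measure (E d)) (U : Set (E d)) : Prop :=
  ∀ K : Set (E d), IsCompact K → K ⊆ U → ν K < ∞

/-- `ν` is `D`-Federer (doubling) on `U`: `ν(3⁻¹ B) > ν(B) / D` for every ball `B ⊆ U` centred on
the support of `ν`. -/
def IsFedererOn {d : ℕ} (ν : Measure (E d)) (D : ℝ) (U : Set (E d)) : Prop :=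
  0 < D ∧ ∀ (x : E d) (r : ℝ), x ∈ ν.support → 0 < r → ball x r ⊆ U →
    ν (ball x r) / ENNReal.ofReal D < ν (ball x (r / 3))

/-- `ν` is `D`-Federer on some neighbourhood of `x`, for some `D > 0`. -/
def IsFedererAt {d : ℕ} (ν : Measure (E d)) (x : E d) : Prop :=
  ∃ (V : Set (E d)) (D : ℝ), IsOpen V ∧ x ∈ V ∧ IsFedererOn ν D V

/-- The affine hyperplane with unit normal vector `u` and offset `c`. -/
def hyperplane {d : ℕ} (u : E d) (c : ℝ) : Set (E d) := {y | inner ℝ u y = c}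

/-- `ν` is absolutely `(C, α)`-decaying on `U`: `ν(B ∩ L^(ε)) ≤ C (ε / r)^α ν(B)` for every ball
`B ⊆ U` of radius `r` centred on the support of `ν`, every affine hyperplane `L` with open
`ε`-neighbourhood `L^(ε)`, and every `ε > 0`. -/
def IsAbsDecayingOn {d : ℕ} (ν : Measure (E d)) (C α : ℝ) (U : Set (E d)) : Prop :=
  0 < C ∧ 0 < α ∧ ∀ (x : E d) (r : ℝ), x ∈ ν.support → 0 < r → ball x r ⊆ U →
    ∀ (u : E d) (c : ℝ), ‖u‖ = 1 → ∀ ε : ℝ, 0 < ε →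
      ν (ball x r ∩ thickening ε (hyperplane u c)) ≤
        ENNReal.ofReal (C * (ε / r) ^ α) * ν (ball x r)

/-- `‖f‖_{ν,B}`, the supremum of `|f|` on `B ∩ supp ν`, with values in `[0, ∞]`. -/
noncomputable def supNorm {d : ℕ} (ν : Measure (E d)) (f : E d → ℝ) (B : Set (E d)) : ℝ≥0∞ :=
  ⨆ x ∈ B ∩ ν.support, ENNReal.ofReal |f x|

/-- `f` is `(C, α)`-good on `U` with respect to `ν`. The quotient `ε / ‖f‖_{ν,B}` is taken in
`[0, ∞]`, so it is `∞` if `f` vanishes on `B ∩ supp ν`, and `0` if `f` is unbounded there. -/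
def IsGoodOn {d : ℕ} (ν : Measure (E d)) (C α : ℝ) (f : E d → ℝ) (U : Set (E d)) : Prop :=
  0 < C ∧ 0 < α ∧ AEMeasurable f (ν.restrict U) ∧
    ∀ (x : E d) (r : ℝ), x ∈ ν.support → 0 < r → ball x r ⊆ U → ∀ ε : ℝ, 0 < ε →
      ν {y ∈ ball x r | |f y| < ε} ≤
        ENNReal.ofReal C * (ENNReal.ofReal ε / supNorm ν f (ball x r)) ^ α * ν (ball x r)

/-- There are a neighbourhood `V ⊆ U` of `x` and a constant `C > 0` such that `s(f)` is
`(C, α)`-good on `V` with respect to `ν` for every symmetric polynomial `s` (with real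
coefficients) of degree at most `k`. -/
def SymGoodNear {d τ : ℕ} (ν : Measure (E d)) (U : Set (E d)) (f : E d → Fin τ → ℝ) (k : ℕ)
    (α : ℝ) (x : E d) : Prop :=
  ∃ (V : Set (E d)) (C : ℝ), IsOpen V ∧ x ∈ V ∧ V ⊆ U ∧
    ∀ s : MvPolynomial (Fin τ) ℝ, s.IsSymmetric → s.totalDegree ≤ k →
      IsGoodOn ν C α (fun y => MvPolynomial.eval (f y) s) V

/-- The number of partitions `l 0 ≥ l 1 ≥ ⋯ ≥ l (τ - 1) ≥ 0` into at most `τ` parts of integers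
at most `k`, that is, the number of Schur polynomials of degree at most `k` in `τ` variables. -/
noncomputable def schurCount (τ k : ℕ) : ℕ :=
  Nat.card {l : Fin τ → ℕ // Antitone l ∧ ∑ i, l i ≤ k}

/-- The values of `N` in the exponents: the number of Schur polynomials of degree at most `k` in
`τ` variables, or the binomial coefficient `(k + τ - 1 choose τ)` in all the cases in which it is
not smaller than that number. -/
def IsAdmissible (τ k N : ℕ) : Prop :=
  N = schurCount τ k ∨
    (N = (k + τ - 1).choose τ ∧ 2 ≤ τ ∧ 2 ≤ k ∧ ¬ (τ = 2 ∧ k = 2))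

/-- The degree of the polynomial map with components `p i`: the maximum of their total degrees. -/
noncomputable def mapDegree {d τ : ℕ} (p : Fin τ → MvPolynomial (Fin d) ℝ) : ℕ :=
  Finset.univ.sup fun i => (p i).totalDegree

end SymGood

/-! The functions `s(f)` form a vector space of dimension at most `schurCount τ k ≤ N`, since a
symmetric polynomial is determined by its coefficients at partitions. On a connected component,
linearly independent analytic functions have a generalized Wronskian, built from derivatives of
order less than their number, that is not identically zero. Such a Wronskian is `W`. Where it does
not vanish, a function of the family whose jet of order `l = N - 1` is zero is itself zero.

Injectivity of the `l`-jets at a point bounds derivatives of order `l + 1` by `l`-jets, uniformly in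
the family and in nearby points (`exists_jet_bound`). After rescaling to any small ball, each
nonzero member then behaves like a polynomial of degree `l` (`IsTame`, `exists_isTame`), and
goodness reduces to estimating sublevel sets of tame functions, in two ways.

For decaying doubling measures (`IsTame.measure_sublevel_le`), a point where `|g|` is small but some
derivative of order at most `l` is not has an order `j < l` with `D^j g` small and `D^(j+1) g`
comparatively large. At a suitable scale such points lie near a hyperplane. Decay bounds them there,
and a covering argument globalizes. The scale involves a square root at each order, whence the
exponent `α₀ / (2 ^ (l + 1) - 2)`.

For Lebesgue measure (`IsTame.volume_sublevel_le`), a large `j`-th derivative gives a large `j`-th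
directional derivative, because symmetric multilinear maps are controlled on the diagonal. A
one-variable estimate along lines and Fubini give the exponent `1 / l`, better than `1 / (d l)`. For
polynomial `f`, the ambient family is all polynomials of degree at most `m = k deg f`; its `m`-jets
are injective at every point, which gives `1 / m`. -/

namespace SymGood

/-! ### Covering argument for doubling measures. -/

/-- A set whose intersections with small balls centred on the support have relative measure at
most `θ` has relative measure at most `θ D²` in a ball, if the measure is doubling. -/
lemma measure_le_of_local_bound {d : ℕ} {ν : Measure (E d)} {D θ : ℝ≥0∞} {A : Set (E d)}
    {y : E d} {r ρ : ℝ} (hρ : 0 < ρ) (hρr : ρ ≤ r) (hA : A ⊆ ball y r)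
    (hD : ∀ z ∈ ball y r ∩ ν.support, ν (ball z ρ) ≤ D * ν (ball z (ρ / 3)))
    (hDy : ν (ball y (3 * r)) ≤ D * ν (ball y r))
    (hloc : ∀ z ∈ A ∩ ν.support, ν (A ∩ ball z ρ) ≤ θ * ν (ball z ρ)) :
    ν A ≤ θ * D ^ 2 * ν (ball y r) := by
  set A' := A ∩ ν.support with hA'
  -- Maximality of the `ρ`-separated set `N` makes the balls of radius `ρ` cover `A'`; separation
  -- makes those of radius `ρ / 3` disjoint.
  obtain ⟨N, hN⟩ := zorn_subset {N : Set (E d) | N ⊆ A' ∧ N.Pairwise fun a b => ρ ≤ dist a b} (by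
    intro c hc hchain
    refine ⟨⋃₀ c, ⟨sUnion_subset fun s hs => (hc hs).1, ?_⟩, fun s hs => subset_sUnion_of_mem hs⟩
    exact (pairwise_sUnion hchain.directedOn).2 fun s hs => (hc hs).2)
  have hcover : A' ⊆ ⋃ z ∈ N, ball z ρ := by
    intro w hw
    by_contra hcon
    simp only [mem_iUnion, mem_ball, not_exists, not_lt] at hcon
    have hins : insert w N ⊆ N := hN.2 (y := insert w N)
      ⟨insert_subset hw hN.1.1, hN.1.2.insert fun b hb _ =>
        ⟨hcon b hb, by rw [dist_comm]; exact hcon b hb⟩⟩ (subset_insert _ _)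
    have := hcon w (hins (mem_insert _ _))
    simp at this
    linarith
  have hdisj : N.PairwiseDisjoint fun z => ball z (ρ / 3) := by
    intro a ha b hb hab
    refine ball_disjoint_ball ?_
    have := hN.1.2 ha hb hab
    linarith
  have hcount : N.Countable := hdisj.countable_of_isOpen (fun _ _ => isOpen_ball)
    fun z _ => nonempty_ball.2 (by positivity)
  have h1 : ν A ≤ ν A' := by
    have : ν A ≤ ν (A' ∪ ν.supportᶜ) := measure_mono fun w hw => by
      by_cases h : w ∈ ν.support
      · exact Or.inl ⟨hw, h⟩
      · exact Or.inr h
    refine this.trans ((measure_union_le _ _).trans ?_)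
    rw [Measure.measure_compl_support, add_zero]
  calc ν A ≤ ν A' := h1
    _ ≤ ν (⋃ z ∈ N, A ∩ ball z ρ) := measure_mono fun w hw => by
        obtain ⟨z, hz, hwz⟩ := mem_iUnion₂.1 (hcover hw)
        exact mem_iUnion₂.2 ⟨z, hz, hw.1, hwz⟩
    _ ≤ ∑' z : N, ν (A ∩ ball z ρ) := measure_biUnion_le _ hcount _
    _ ≤ ∑' z : N, θ * D * ν (ball z (ρ / 3)) := by
        refine ENNReal.tsum_le_tsum fun z => ?_
        have hz := hN.1.1 z.2
        calc _ ≤ θ * ν (ball z ρ) := hloc z hz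
          _ ≤ θ * (D * ν (ball z (ρ / 3))) := by gcongr; exact hD z ⟨hA hz.1, hz.2⟩
          _ = _ := by ring
    _ = θ * D * ν (⋃ z ∈ N, ball z (ρ / 3)) := by
        rw [ENNReal.tsum_mul_left, measure_biUnion hcount hdisj fun _ _ => measurableSet_ball]
    -- The small balls may stick out of `ball y r`; returning from `3 * r` to `r` costs the second
    -- factor `D`.
    _ ≤ θ * D * ν (ball y (3 * r)) := by
        gcongr
        refine iUnion₂_subset fun z hz => ?_
        have := mem_ball.1 (hA (hN.1.1 hz).1)
        exact ball_subset_ball' (by linarith)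
    _ ≤ θ * D * (D * ν (ball y r)) := by gcongr
    _ = _ := by ring

/-! ### Sublevel sets near hyperplanes, where the derivative is large. -/

lemma mem_thickening_hyperplane {d : ℕ} {u w : E d} {c ε : ℝ} (hu : ‖u‖ = 1)
    (h : |inner ℝ u w - c| < ε) : w ∈ thickening ε (hyperplane u c) := by
  rw [mem_thickening_iff]
  refine ⟨w - (inner ℝ u w - c) • u, ?_, ?_⟩
  · simp [hyperplane, inner_sub_right, inner_smul_right, hu]
  · simpa [dist_eq_norm, norm_smul, hu] using h

/-- A linear map `T` that is not small is small only near a hyperplane. -/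
lemma exists_unit_inner_bound {d : ℕ} {F : Type*} [NormedAddCommGroup F] [NormedSpace ℝ F]
    (T : E d →L[ℝ] F) {δ : ℝ} (hδ : 0 < δ) (hT : δ ≤ ‖T‖) :
    ∃ u : E d, ‖u‖ = 1 ∧ ∀ w, |inner ℝ u w| ≤ 2 / δ * ‖T w‖ := by
  -- `v` nearly attains the norm of `T` and `φ` norms `T v`; the vector representing `φ ∘ T` then
  -- has length at least `δ / 2`, and `u` is its normalization.
  obtain ⟨v, hv, hTv⟩ := T.exists_lt_apply_of_lt_opNorm (r := δ / 2) (by linarith)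
  obtain ⟨φ, hφ, hφv⟩ := exists_dual_vector'' ℝ (T v)
  set a : E d := (InnerProductSpace.toDual ℝ (E d)).symm (φ.comp T) with ha
  have hin : ∀ w, inner ℝ a w = φ (T w) := fun w => by simp [ha]
  have hna : δ / 2 ≤ ‖a‖ := by
    have h1 : δ / 2 < φ (T v) := by rw [hφv]; exact hTv
    have h2 : φ (T v) ≤ ‖a‖ * ‖v‖ := by rw [← hin]; exact real_inner_le_norm a v
    nlinarith [norm_nonneg a]
  have hpos : 0 < ‖a‖ := by linarith
  refine ⟨‖a‖⁻¹ • a, by simp [norm_smul, hpos.ne'], fun w => ?_⟩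
  rw [real_inner_smul_left, hin, abs_mul, abs_of_pos (inv_pos.2 hpos)]
  have h3 : |φ (T w)| ≤ ‖T w‖ := by
    simpa using (φ.le_opNorm (T w)).trans (mul_le_of_le_one_left (norm_nonneg _) hφ)
  have h4 : ‖a‖⁻¹ ≤ 2 / δ := by
    rw [inv_le_comm₀ hpos (by positivity)]
    simpa using hna
  gcongr

/-- Taylor's formula of order one with quadratic remainder on a ball. -/
lemma norm_sub_sub_fderiv_le {d : ℕ} {F : Type*} [NormedAddCommGroup F] [NormedSpace ℝ F]
    {Φ : E d → F} {y z w : E d} {r ρ M : ℝ} (hΦ : ∀ x ∈ ball y r, DifferentiableAt ℝ Φ x)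
    (hM : ∀ x ∈ ball y r, ∀ x' ∈ ball y r, ‖fderiv ℝ Φ x - fderiv ℝ Φ x'‖ ≤ M * ‖x - x'‖)
    (hM0 : 0 ≤ M) (hz : z ∈ ball y r) (hw : w ∈ ball y r) (hzw : dist w z < ρ) :
    ‖Φ w - Φ z - fderiv ℝ Φ z (w - z)‖ ≤ M * ρ ^ 2 := by
  have hρ : 0 < ρ := dist_nonneg.trans_lt hzw
  have hconv : Convex ℝ (ball y r ∩ ball z ρ) := (convex_ball _ _).inter (convex_ball _ _)
  have := hconv.norm_image_sub_le_of_norm_fderiv_le' (f := Φ) (C := M * ρ) (φ := fderiv ℝ Φ z)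
    (x := z) (y := w) (𝕜 := ℝ) (fun x hx => hΦ x hx.1) (fun x hx => (hM x hx.1 z hz).trans (by
      have := mem_ball.1 hx.2
      rw [dist_eq_norm] at this
      gcongr)) ⟨hz, mem_ball_self hρ⟩ ⟨hw, hzw⟩
  refine this.trans ?_
  rw [dist_eq_norm] at hzw
  calc M * ρ * ‖w - z‖ ≤ M * ρ * ρ := by gcongr
    _ = _ := by ring

/-- The part of the sublevel set of `‖Φ‖` where the derivative is large lies, in a small ball,
near a hyperplane. -/
lemma exists_hyperplane_of_fderiv_large {d : ℕ} {F : Type*} [NormedAddCommGroup F]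
    [NormedSpace ℝ F] {Φ : E d → F} {y z : E d} {r ρ M δ δ' ε : ℝ}
    (hΦ : ∀ x ∈ ball y r, DifferentiableAt ℝ Φ x)
    (hM : ∀ x ∈ ball y r, ∀ x' ∈ ball y r, ‖fderiv ℝ Φ x - fderiv ℝ Φ x'‖ ≤ M * ‖x - x'‖)
    (hM0 : 0 ≤ M) (hδ' : 0 < δ') (hz : z ∈ ball y r) (hzδ : ‖Φ z‖ < δ)
    (hzδ' : δ' ≤ ‖fderiv ℝ Φ z‖) (hε : 2 / δ' * (2 * δ + M * ρ ^ 2) ≤ ε) :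
    ∃ u c, ‖u‖ = 1 ∧ {w ∈ ball y r | ‖Φ w‖ < δ} ∩ ball z ρ ⊆ thickening ε (hyperplane u c) := by
  obtain ⟨u, hu, hub⟩ := exists_unit_inner_bound (fderiv ℝ Φ z) hδ' hzδ'
  refine ⟨u, inner ℝ u z, hu, ?_⟩
  rintro w ⟨⟨hw, hwδ⟩, hwz⟩
  refine mem_thickening_hyperplane hu ?_
  rw [← inner_sub_right]
  refine (hub _).trans_lt (lt_of_lt_of_le ?_ hε)
  have h := norm_sub_sub_fderiv_le hΦ hM hM0 hz hw hwz
  gcongr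
  have h2 : ‖fderiv ℝ Φ z (w - z)‖ ≤ ‖Φ w‖ + ‖Φ z‖ + ‖Φ w - Φ z - fderiv ℝ Φ z (w - z)‖ := by
    have h3 : fderiv ℝ Φ z (w - z) = Φ w - Φ z - (Φ w - Φ z - fderiv ℝ Φ z (w - z)) := by abel
    calc ‖fderiv ℝ Φ z (w - z)‖ = ‖Φ w - Φ z - (Φ w - Φ z - fderiv ℝ Φ z (w - z))‖ := by rw [← h3]
      _ ≤ ‖Φ w - Φ z‖ + _ := norm_sub_le _ _
      _ ≤ _ := by gcongr; exact norm_sub_le _ _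
  linarith

/-! ### Tame functions and absolutely decaying measures. -/

/-- On the ball `B` of radius `r` the function `g` looks like a polynomial of degree `l` of size
`Γ`: all `r ^ j ‖D^j g‖` with `j ≤ l + 1` are at most `K Γ` and, at each point, one of them with
`j ≤ l` is at least `Γ`. -/
structure IsTame {d : ℕ} (l : ℕ) (K : ℝ) (g : E d → ℝ) (y : E d) (r Γ : ℝ) : Prop where
  analytic : AnalyticOnNhd ℝ g (ball y r)
  upper : ∀ z ∈ ball y r, ∀ j ≤ l + 1, r ^ j * ‖iteratedFDeriv ℝ j g z‖ ≤ K * Γ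
  lower : ∀ z ∈ ball y r, ∃ j ≤ l, Γ ≤ r ^ j * ‖iteratedFDeriv ℝ j g z‖

lemma differentiableAt_iteratedFDeriv {d : ℕ} {g : E d → ℝ} {U : Set (E d)} (hU : IsOpen U)
    (hg : AnalyticOnNhd ℝ g U) (j : ℕ) {z : E d} (hz : z ∈ U) :
    DifferentiableAt ℝ (iteratedFDeriv ℝ j g) z :=
  (hg.iteratedFDeriv_of_isOpen hU j z hz).differentiableAt

lemma norm_iteratedFDeriv_sub_le {d : ℕ} {g : E d → ℝ} {y : E d} {r M : ℝ}
    (hg : AnalyticOnNhd ℝ g (ball y r)) (j : ℕ)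
    (hM : ∀ z ∈ ball y r, ‖iteratedFDeriv ℝ (j + 1) g z‖ ≤ M) {x x' : E d}
    (hx : x ∈ ball y r) (hx' : x' ∈ ball y r) :
    ‖iteratedFDeriv ℝ j g x - iteratedFDeriv ℝ j g x'‖ ≤ M * ‖x - x'‖ :=
  (convex_ball y r).norm_image_sub_le_of_norm_fderiv_le (𝕜 := ℝ)
    (fun _ hz => differentiableAt_iteratedFDeriv isOpen_ball hg j hz)
    (fun z hz => by rw [norm_fderiv_iteratedFDeriv]; exact hM z hz) hx' hx

lemma norm_fderiv_iteratedFDeriv_sub {d : ℕ} (g : E d → ℝ) (j : ℕ) (x x' : E d) :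
    ‖fderiv ℝ (iteratedFDeriv ℝ j g) x - fderiv ℝ (iteratedFDeriv ℝ j g) x'‖ =
      ‖iteratedFDeriv ℝ (j + 1) g x - iteratedFDeriv ℝ (j + 1) g x'‖ := by
  rw [fderiv_iteratedFDeriv]
  simp only [Function.comp_apply]
  rw [← LinearIsometryEquiv.map_sub, LinearIsometryEquiv.norm_map]

section Federer

variable {d : ℕ} {ν : Measure (E d)} {D : ℝ} {V : Set (E d)}

lemma IsFedererOn.measure_ball_le (h : IsFedererOn ν D V) {x : E d} {r : ℝ} (hx : x ∈ ν.support)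
    (hr : 0 < r) (hV : ball x r ⊆ V) :
    ν (ball x r) ≤ ENNReal.ofReal D * ν (ball x (r / 3)) := by
  have := (h.2 x r hx hr hV).le
  rwa [ENNReal.div_le_iff_le_mul (Or.inl (by simpa using h.1)) (Or.inl ENNReal.ofReal_ne_top),
    mul_comm] at this

lemma IsFedererOn.measure_le_of_local_bound (h : IsFedererOn ν D V) {θ : ℝ≥0∞} {A : Set (E d)}
    {y : E d} {r ρ : ℝ} (hy : y ∈ ν.support) (hρ : 0 < ρ) (hρr : ρ ≤ r) (hV : ball y (3 * r) ⊆ V)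
    (hA : A ⊆ ball y r)
    (hloc : ∀ z ∈ A ∩ ν.support, ν (A ∩ ball z ρ) ≤ θ * ν (ball z ρ)) :
    ν A ≤ θ * ENNReal.ofReal D ^ 2 * ν (ball y r) := by
  refine SymGood.measure_le_of_local_bound hρ hρr hA (fun z hz => ?_) ?_ hloc
  · refine h.measure_ball_le hz.2 hρ ((ball_subset_ball' ?_).trans hV)
    have := mem_ball.1 hz.1
    linarith
  · have := h.measure_ball_le (r := 3 * r) hy (by linarith) hV
    rwa [mul_div_cancel_left₀ _ (three_ne_zero)] at this

end Federer

/-- At scale `ρ = r √δ` the quadratic Taylor error of `D^j g` has the same order `δ Γ / r ^ j` as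
the bound on `D^j g` itself. Dividing by the lower bound on `D^(j+1) g` confines the set, in each
`ρ`-ball centred on it and on the support, to a neighbourhood of a hyperplane of width a multiple of
`(√δ / δ') ρ`. Decay applies at this scale, then the covering argument. -/
lemma IsTame.measure_small_jet_le {d : ℕ} {ν : Measure (E d)} {C₀ α₀ D K r Γ δ δ' : ℝ}
    {U V : Set (E d)} {g : E d → ℝ} {y : E d} {l j : ℕ}
    (hdec : IsAbsDecayingOn ν C₀ α₀ U) (hfed : IsFedererOn ν D V) (hg : IsTame l K g y r Γ)
    (hK : 0 ≤ K) (hy : y ∈ ν.support) (hr : 0 < r) (hU : ball y (3 * r) ⊆ U)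
    (hV : ball y (3 * r) ⊆ V) (hΓ : 0 < Γ) (hδ : 0 < δ) (hδ1 : δ ≤ 1) (hδ' : 0 < δ')
    (hj : j < l) :
    ν {w ∈ ball y r | r ^ j * ‖iteratedFDeriv ℝ j g w‖ < δ * Γ ∧
        δ' * Γ ≤ r ^ (j + 1) * ‖iteratedFDeriv ℝ (j + 1) g w‖} ≤
      ENNReal.ofReal (C₀ * (2 * (2 + K) * (√δ / δ')) ^ α₀) * ENNReal.ofReal D ^ 2 *
        ν (ball y r) := by
  obtain ⟨hC₀, hα₀, hdec⟩ := hdec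
  have hs : 0 < √δ := Real.sqrt_pos.2 hδ
  have hs1 : √δ ≤ 1 := by simpa using Real.sqrt_le_sqrt hδ1
  have hss : √δ ^ 2 = δ := Real.sq_sqrt hδ.le
  refine hfed.measure_le_of_local_bound (ρ := r * √δ) hy (by positivity)
    (mul_le_of_le_one_right hr.le hs1) hV (fun w hw => hw.1) ?_
  rintro z ⟨⟨hz, hz1, hz2⟩, hzs⟩
  obtain ⟨u, c, hu, hsub⟩ := exists_hyperplane_of_fderiv_large (Φ := iteratedFDeriv ℝ j g)
    (y := y) (z := z) (r := r) (ρ := r * √δ) (M := K * Γ / r ^ (j + 2)) (δ := δ * Γ / r ^ j)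
    (δ' := δ' * Γ / r ^ (j + 1)) (ε := 2 * (2 + K) * (√δ / δ') * (r * √δ))
    (fun x hx => differentiableAt_iteratedFDeriv isOpen_ball hg.analytic j hx)
    (fun x hx x' hx' => by
      rw [norm_fderiv_iteratedFDeriv_sub]
      refine norm_iteratedFDeriv_sub_le hg.analytic (j + 1) (fun z hz => ?_) hx hx'
      rw [le_div_iff₀ (by positivity), mul_comm]
      -- The Taylor remainder of `D^j g` uses the derivative of order `j + 2`; for `j = l - 1` this
      -- is order `l + 1`, the last one controlled by tameness.
      exact hg.upper z hz (j + 2) (by omega))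
    (by positivity) (by positivity) hz
    (by rw [lt_div_iff₀ (by positivity), mul_comm]; exact hz1)
    (by rw [norm_fderiv_iteratedFDeriv, div_le_iff₀ (by positivity), mul_comm _ (r ^ _)]
        exact hz2)
    (le_of_eq (by
      rw [mul_pow, hss]
      have : 2 * (2 + K) * (√δ / δ') * (r * √δ) = 2 * (2 + K) * r * √δ ^ 2 / δ' := by ring
      rw [this, hss]
      field_simp
      ring))
  have hsub2 : ball z (r * √δ) ⊆ U := by
    refine (ball_subset_ball' ?_).trans hU
    have := mem_ball.1 hz
    nlinarith
  refine (measure_mono ?_).trans ((hdec z (r * √δ) hzs (by positivity) hsub2 u c hu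
    (2 * (2 + K) * (√δ / δ') * (r * √δ)) (by positivity)).trans_eq ?_)
  · rintro w ⟨⟨hw, hw1, -⟩, hwz⟩
    refine ⟨hwz, hsub ⟨⟨hw, ?_⟩, hwz⟩⟩
    rw [lt_div_iff₀ (by positivity), mul_comm]
    exact hw1
  · rw [mul_div_cancel_right₀ _ (by positivity)]

/-- Sublevel sets of tame functions have small measure with respect to absolutely decaying
doubling measures. -/
theorem IsTame.measure_sublevel_le {d : ℕ} {ν : Measure (E d)} {C₀ α₀ D K r Γ ε : ℝ}
    {U V : Set (E d)} {g : E d → ℝ} {y : E d} {l : ℕ}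
    (hdec : IsAbsDecayingOn ν C₀ α₀ U) (hfed : IsFedererOn ν D V) (hg : IsTame l K g y r Γ)
    (hK : 0 ≤ K) (hy : y ∈ ν.support) (hr : 0 < r) (hU : ball y (3 * r) ⊆ U)
    (hV : ball y (3 * r) ⊆ V) (hΓ : 0 < Γ) (hε : 0 < ε) (hεΓ : ε ≤ Γ) (hl : 0 < l) :
    ν {w ∈ ball y r | |g w| < ε} ≤
      ENNReal.ofReal (l * (C₀ * (2 * (2 + K)) ^ α₀ * D ^ 2) *
        (ε / Γ) ^ (α₀ / (2 ^ (l + 1) - 2))) * ν (ball y r) := by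
  have hC₀ := hdec.1
  have hα₀ := hdec.2.1
  have hD := hfed.1
  set β : ℝ := 2 ^ (l + 1) - 2 with hβ
  have hβ0 : 0 < β := by
    have : (2 : ℝ) ^ 1 < 2 ^ (l + 1) := pow_lt_pow_right₀ one_lt_two (by omega)
    rw [hβ]; linarith
  set e := ε / Γ with he
  have he0 : 0 < e := by positivity
  have he1 : e ≤ 1 := (div_le_one hΓ).2 hεΓ
  -- The thresholds `δ j = e ^ γ j` run from `e` at `j = 0` to `1` at `j = l`, and `γ` solves the
  -- recursion `γ j / 2 - γ (j + 1) = 1 / β`, so that every order `j` contributes the same power of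
  -- `e`.
  set γ : ℕ → ℝ := fun j => (2 ^ (l + 1 - j) - 2) / β with hγ
  set δ : ℕ → ℝ := fun j => e ^ γ j with hδ
  have hγ0 : γ 0 = 1 := by simp [hγ, ← hβ, hβ0.ne']
  have hγl : γ l = 0 := by simp [hγ]
  have hγnn : ∀ j ≤ l, 0 ≤ γ j := fun j hj => by
    have : (2 : ℝ) ^ 1 ≤ 2 ^ (l + 1 - j) := pow_le_pow_right₀ one_le_two (by omega)
    refine div_nonneg ?_ hβ0.le
    linarith
  have hγs : ∀ j < l, γ j / 2 - γ (j + 1) = 1 / β := fun j hj => by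
    obtain ⟨i, rfl⟩ := Nat.exists_eq_add_of_lt hj
    have h1 : j + i + 1 + 1 - j = i + 2 := by omega
    have h2 : j + i + 1 + 1 - (j + 1) = i + 1 := by omega
    simp only [hγ, h1, h2]
    field_simp
    ring
  have hδ0 : ∀ j, 0 < δ j := fun j => Real.rpow_pos_of_pos he0 _
  have hδ1 : ∀ j ≤ l, δ j ≤ 1 := fun j hj => Real.rpow_le_one he0.le he1 (hγnn j hj)
  have hquot : ∀ j < l, √(δ j) / δ (j + 1) = e ^ (1 / β) := fun j hj => by
    rw [Real.sqrt_eq_rpow, hδ, ← Real.rpow_mul he0.le, ← Real.rpow_sub he0, ← hγs j hj]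
    congr 1; ring
  set S : ℕ → Set (E d) := fun j => {w ∈ ball y r | r ^ j * ‖iteratedFDeriv ℝ j g w‖ < δ j * Γ ∧
        δ (j + 1) * Γ ≤ r ^ (j + 1) * ‖iteratedFDeriv ℝ (j + 1) g w‖} with hS
  have hsub : {w ∈ ball y r | |g w| < ε} ⊆ ⋃ j ∈ Finset.range l, S j := by
    rintro w ⟨hw, hwε⟩
    by_contra hcon
    simp only [mem_iUnion, Finset.mem_range, not_exists, hS, mem_ofPred_eq, not_and, not_le] at hcon
    -- If no order were a transition from small to large, all derivatives up to order `l` would be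
    -- below their thresholds, contradicting `lower`.
    have hall : ∀ j ≤ l, r ^ j * ‖iteratedFDeriv ℝ j g w‖ < δ j * Γ := by
      intro j
      induction j with
      | zero =>
        intro _
        have : e * Γ = ε := div_mul_cancel₀ _ hΓ.ne'
        simpa [hδ, hγ0, this] using hwε
      | succ j ih => exact fun hj => hcon j (by omega) hw (ih (by omega))
    obtain ⟨j, hj, hjΓ⟩ := hg.lower w hw
    have h1 := hall j hj
    have h2 := hδ1 j hj
    nlinarith
  have hSj : ∀ j ∈ Finset.range l, ν (S j) ≤
      ENNReal.ofReal (C₀ * (2 * (2 + K)) ^ α₀ * D ^ 2 * e ^ (α₀ / β)) * ν (ball y r) := by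
    intro j hj
    rw [Finset.mem_range] at hj
    refine (hg.measure_small_jet_le hdec hfed hK hy hr hU hV hΓ (hδ0 j) (hδ1 j hj.le)
      (hδ0 (j + 1)) hj).trans_eq ?_
    rw [hquot j hj, ← ENNReal.ofReal_pow hD.le, ← ENNReal.ofReal_mul (by positivity),
      Real.mul_rpow (by positivity) (by positivity), ← Real.rpow_mul he0.le]
    congr 2
    rw [show 1 / β * α₀ = α₀ / β by ring]
    ring
  calc ν {w ∈ ball y r | |g w| < ε} ≤ ν (⋃ j ∈ Finset.range l, S j) := measure_mono hsub
    _ ≤ ∑ j ∈ Finset.range l, ν (S j) := measure_biUnion_finset_le _ _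
    _ ≤ ∑ j ∈ Finset.range l, _ := Finset.sum_le_sum hSj
    _ = _ := by
      rw [Finset.sum_const, Finset.card_range, nsmul_eq_mul, ← mul_assoc, ← ENNReal.ofReal_natCast,
        ← ENNReal.ofReal_mul (by positivity), mul_assoc (l : ℝ)]

/-! ### Lebesgue measure: sublevel sets in one variable and slicing by lines. -/

/-- If the `j`-th derivative of `u 0` is at least `c > 0` on a convex set, then the set where
`|u 0| < c q ^ j` has length at most `(2 ^ (j + 1) - 2) q`. -/
lemma volume_sublevel_le_of_deriv_ge (j : ℕ) (u : ℕ → ℝ → ℝ) (I : Set ℝ) (hI : Convex ℝ I)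
    {c q : ℝ} (hc : 0 < c) (hq : 0 < q)
    (hu : ∀ i < j, ∀ t ∈ I, HasDerivAt (u i) (u (i + 1) t) t) (huj : ∀ t ∈ I, c ≤ u j t) :
    volume {t ∈ I | |u 0 t| < c * q ^ j} ≤ ENNReal.ofReal ((2 ^ (j + 1) - 2) * q) := by
  induction j generalizing u I c with
  | zero =>
    have : {t ∈ I | |u 0 t| < c * q ^ 0} = ∅ := by
      refine eq_empty_of_forall_notMem fun t ht => ?_
      have h1 := huj t ht.1
      have h2 := ht.2
      have h3 := le_abs_self (u 0 t)
      rw [pow_zero, mul_one] at h2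
      linarith
    rw [this]
    simp
  | succ j ih =>
    -- `u j` increases at rate at least `c`, so `|u j| < c q` only on a set of diameter at most `2
    -- q`; on each of the two convex remaining pieces induction applies to `± u` with `c q` in place
    -- of `c`. The lengths add up to `2 (2 ^ (j + 1) - 2) q + 2 q`.
    have hdiff : ∀ s ∈ I, ∀ t ∈ I, s ≤ t → c * (t - s) ≤ u j t - u j s := by
      intro s hs t ht hst
      have hsub : Icc s t ⊆ I := hI.ordConnected.out hs ht
      refine (convex_Icc s t).mul_sub_le_image_sub_of_le_deriv
        (fun x hx => (hu j (by omega) x (hsub hx)).continuousAt.continuousWithinAt)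
        (fun x hx => (hu j (by omega) x (hsub (interior_subset hx))
          ).differentiableAt.differentiableWithinAt) (fun x hx => ?_) s ⟨le_rfl, hst⟩ t
          ⟨hst, le_rfl⟩ hst
      rw [(hu j (by omega) x (hsub (interior_subset hx))).deriv]
      exact huj x (hsub (interior_subset hx))
    have hmono : MonotoneOn (u j) I := fun s hs t ht hst => by
      have := hdiff s hs t ht hst
      nlinarith
    have hcq : 0 < c * q := by positivity
    have hp : Convex ℝ {t ∈ I | c * q ≤ u j t} := by
      refine OrdConnected.convex ⟨fun s hs t ht x hx => ?_⟩
      have hxI := hI.ordConnected.out hs.1 ht.1 hx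
      exact ⟨hxI, hs.2.trans (hmono hs.1 hxI hx.1)⟩
    have hn : Convex ℝ {t ∈ I | u j t ≤ -(c * q)} := by
      refine OrdConnected.convex ⟨fun s hs t ht x hx => ?_⟩
      have hxI := hI.ordConnected.out hs.1 ht.1 hx
      exact ⟨hxI, (hmono hxI ht.1 hx.2).trans ht.2⟩
    have h1 := ih u _ hp hcq (fun i hi t ht => hu i (by omega) t ht.1) fun t ht => ht.2
    have h2 := ih (fun i t => -u i t) _ hn hcq
      (fun i hi t ht => (hu i (by omega) t ht.1).neg) fun t ht => by linarith [ht.2]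
    have h3 : volume {t ∈ I | |u j t| < c * q} ≤ ENNReal.ofReal (2 * q) := by
      refine (Real.volume_le_diam _).trans (ediam_le_of_forall_dist_le fun s hs t ht => ?_)
      wlog hst : s ≤ t generalizing s t
      · rw [dist_comm]; exact this t ht s hs (le_of_not_ge hst)
      have h := hdiff s hs.1 t ht.1 hst
      have h4 := abs_lt.1 hs.2
      have h5 := abs_lt.1 ht.2
      rw [dist_comm, Real.dist_eq, abs_of_nonneg (by linarith)]
      nlinarith
    have hsub : {t ∈ I | |u 0 t| < c * q ^ (j + 1)} ⊆
        ({t ∈ {t ∈ I | c * q ≤ u j t} | |u 0 t| < c * q * q ^ j} ∪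
          {t ∈ {t ∈ I | u j t ≤ -(c * q)} | |-u 0 t| < c * q * q ^ j}) ∪
          {t ∈ I | |u j t| < c * q} := by
      rintro t ⟨ht, htu⟩
      rw [pow_succ', ← mul_assoc] at htu
      rcases lt_or_ge |u j t| (c * q) with h | h
      · exact Or.inr ⟨ht, h⟩
      · rcases le_abs'.1 h with h | h
        · exact Or.inl (Or.inr ⟨⟨ht, h⟩, by rwa [abs_neg]⟩)
        · exact Or.inl (Or.inl ⟨⟨ht, h⟩, htu⟩)
    have h0 : (0 : ℝ) ≤ 2 ^ (j + 1) - 2 := by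
      have : (1 : ℝ) ≤ 2 ^ j := one_le_pow₀ one_le_two
      rw [pow_succ]; linarith
    refine (measure_mono hsub).trans ((measure_union_le _ _).trans
      ((add_le_add ((measure_union_le _ _).trans (add_le_add h1 h2)) h3).trans_eq ?_))
    rw [← ENNReal.ofReal_add (by positivity) (by positivity),
      ← ENNReal.ofReal_add (by positivity) (by positivity)]
    congr 1
    ring

/-- A measurable set which meets all lines of direction `v` in small sets has small measure. -/
lemma volume_le_of_slices {d : ℕ} {A : Set (E d)} (hA : MeasurableSet A) {z v : E d} {ρ : ℝ}
    (hρ : 0 < ρ) (hAρ : A ⊆ ball z ρ) (hv : ‖v‖ ≤ 1) {b : ℝ≥0∞}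
    (hb : ∀ w : E d, volume {t : ℝ | w + t • v ∈ A} ≤ b) :
    ENNReal.ofReal (2 * ρ) * volume A ≤ b * volume (ball z (2 * ρ)) := by
  have hmeas : MeasurableSet {p : E d × ℝ | p.1 + p.2 • v ∈ A} :=
    (by fun_prop : Measurable fun p : E d × ℝ => p.1 + p.2 • v) hA
  calc ENNReal.ofReal (2 * ρ) * volume A
      = ∫⁻ t in Icc (-ρ) ρ, volume A := by
        rw [setLIntegral_const, Real.volume_Icc, mul_comm]; congr 2; ring
    -- Every translate of `A` by `t • v` has the volume of `A`; exchanging the integrals turns the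
    -- average over translates into an integral of slice lengths.
    _ = ∫⁻ t in Icc (-ρ) ρ, ∫⁻ w : E d, {p : E d × ℝ | p.1 + p.2 • v ∈ A}.indicator 1 (w, t) := by
        refine lintegral_congr fun t => ?_
        have h1 : (fun w : E d => {p : E d × ℝ | p.1 + p.2 • v ∈ A}.indicator
            (1 : E d × ℝ → ℝ≥0∞) (w, t)) = ((fun w => w + t • v) ⁻¹' A).indicator 1 := by
          ext w; rfl
        rw [h1, lintegral_indicator_one ((measurable_add_const _) hA), measure_preimage_add_right]
    _ = ∫⁻ w : E d, ∫⁻ t in Icc (-ρ) ρ, {p : E d × ℝ | p.1 + p.2 • v ∈ A}.indicator 1 (w, t) := by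
        refine lintegral_lintegral_swap ?_
        exact ((measurable_one.indicator hmeas).comp measurable_swap).aemeasurable
    _ ≤ ∫⁻ w : E d, (ball z (2 * ρ)).indicator (fun _ => b) w := by
        refine lintegral_mono fun w => ?_
        -- Since `‖t • v‖ ≤ ρ`, only base points within `2 * ρ` of `z` can reach `A`.
        by_cases hw : w ∈ ball z (2 * ρ)
        · rw [indicator_of_mem hw]
          refine le_trans ?_ (hb w)
          have hm : MeasurableSet {t : ℝ | w + t • v ∈ A} :=
            (by fun_prop : Measurable fun t : ℝ => w + t • v) hA
          rw [← lintegral_indicator_one hm]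
          exact setLIntegral_le_lintegral _ _
        · rw [indicator_of_notMem hw]
          refine le_of_eq (setLIntegral_eq_zero measurableSet_Icc fun t ht => ?_)
          refine indicator_of_notMem (fun hmem => hw ?_) _
          have h1 : dist (w + t • v) z < ρ := hAρ hmem
          have h2 : ‖t • v‖ ≤ ρ := by
            rw [norm_smul, Real.norm_eq_abs]
            calc |t| * ‖v‖ ≤ ρ * 1 := by
                  gcongr
                  exact abs_le.2 ht
              _ = ρ := mul_one _
          rw [dist_eq_norm] at h1
          rw [mem_ball, dist_eq_norm]
          calc ‖w - z‖ = ‖(w + t • v - z) - t • v‖ := by congr 1; abel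
            _ ≤ ‖w + t • v - z‖ + ‖t • v‖ := norm_sub_le _ _
            _ < 2 * ρ := by linarith
    _ = _ := by rw [lintegral_indicator_const measurableSet_ball]

/-! ### Symmetric multilinear maps and their diagonals. -/

instance finiteDimensional_continuousMultilinearMap (d n : ℕ) :
    FiniteDimensional ℝ (E d [×n]→L[ℝ] ℝ) :=
  Module.Finite.of_injective
    (ContinuousMultilinearMap.toMultilinearMapLinear (R' := ℝ) (A := ℝ)
      (M₁ := fun _ : Fin n => E d) (M₂ := ℝ)) ContinuousMultilinearMap.toMultilinearMap_injective

/-- A symmetric multilinear map vanishing on the diagonal is zero. -/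
lemma eq_zero_of_diagonal_eq_zero {d n : ℕ} (f : E d [×n]→L[ℝ] ℝ)
    (hsymm : ∀ (v : Fin n → E d) (σ : Equiv.Perm (Fin n)), f (fun i => v (σ i)) = f v)
    (hdiag : ∀ x, f (fun _ => x) = 0) : f = 0 := by
  ext v
  -- Polarization: the `n`-th derivative of `x ↦ f (x, …, x)` is the sum of `f` over all
  -- permutations of `v`, that is, `n! f v` by symmetry.
  have h := f.iteratedFDeriv_comp_diagonal 0 v
  have h0 : (fun x : E d => f fun _ => x) = fun _ => 0 := funext hdiag
  simp only [h0, hsymm, Finset.sum_const, Finset.card_univ] at h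
  have : iteratedFDeriv ℝ n (fun _ : E d => (0 : ℝ)) 0 = 0 := by
    have := iteratedFDeriv_fun_zero (𝕜 := ℝ) (E := E d) (F := ℝ) (n := n)
    exact congrFun this 0
  rw [this, Fintype.card_perm] at h
  simpa [eq_comm, Nat.factorial_ne_zero] using h

/-- The norm of a symmetric multilinear map is controlled by its values on the diagonal. -/
lemma exists_diagonal_bound (d n : ℕ) : ∃ c : ℝ, 0 < c ∧ ∀ f : E d [×n]→L[ℝ] ℝ,
    (∀ (v : Fin n → E d) (σ : Equiv.Perm (Fin n)), f (fun i => v (σ i)) = f v) →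
    ∃ v : E d, ‖v‖ ≤ 1 ∧ c * ‖f‖ ≤ |f fun _ => v| := by
  have : ProperSpace (E d [×n]→L[ℝ] ℝ) := FiniteDimensional.proper ℝ _
  set S : Set (E d [×n]→L[ℝ] ℝ) :=
    {f | ∀ (v : Fin n → E d) (σ : Equiv.Perm (Fin n)), f (fun i => v (σ i)) = f v} with hS
  have hSc : IsClosed S := by
    simp only [hS, ofPred_forall]
    exact isClosed_iInter fun v => isClosed_iInter fun σ => isClosed_eq
      (continuous_eval_const _) (continuous_eval_const _)
  have hcomp : IsCompact (S ∩ sphere 0 1) := (isCompact_sphere 0 1).inter_left hSc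
  obtain ⟨c, hc, hbound⟩ : ∃ c : ℝ, 0 < c ∧ ∀ f ∈ S ∩ sphere 0 1,
      ∃ v : E d, ‖v‖ ≤ 1 ∧ c ≤ |f fun _ => v| := by
    -- A direction `v` that works for `f` works, with half the constant, for all nearby maps;
    -- compactness of the unit sphere of symmetric maps makes the constant uniform.
    refine hcomp.induction_on (p := fun T => ∃ c : ℝ, 0 < c ∧ ∀ f ∈ T,
      ∃ v : E d, ‖v‖ ≤ 1 ∧ c ≤ |f fun _ => v|) ⟨1, one_pos, by simp⟩ ?_ ?_ ?_
    · rintro s t hst ⟨c, hc, h⟩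
      exact ⟨c, hc, fun f hf => h f (hst hf)⟩
    · rintro s t ⟨c, hc, h⟩ ⟨c', hc', h'⟩
      refine ⟨min c c', lt_min hc hc', fun f hf => ?_⟩
      rcases hf with hf | hf
      · obtain ⟨v, hv, hcv⟩ := h f hf
        exact ⟨v, hv, (min_le_left _ _).trans hcv⟩
      · obtain ⟨v, hv, hcv⟩ := h' f hf
        exact ⟨v, hv, (min_le_right _ _).trans hcv⟩
    · rintro f ⟨hfS, hf1⟩
      have hf0 : f ≠ 0 := by
        rintro rfl
        simp at hf1
      obtain ⟨x, hx⟩ : ∃ x, f (fun _ => x) ≠ 0 := by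
        by_contra hcon
        push Not at hcon
        exact hf0 (eq_zero_of_diagonal_eq_zero f hfS hcon)
      obtain ⟨v, hv, hfv⟩ : ∃ v : E d, ‖v‖ ≤ 1 ∧ f (fun _ => v) ≠ 0 := by
        refine ⟨(1 + ‖x‖)⁻¹ • x, ?_, ?_⟩
        · rw [norm_smul, norm_inv, Real.norm_of_nonneg (by positivity), inv_mul_le_one₀
            (by positivity)]
          linarith
        · have := f.map_smul_univ (fun _ => (1 + ‖x‖)⁻¹) (fun _ => x)
          rw [this]
          have : (1 + ‖x‖)⁻¹ ≠ 0 := by positivity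
          exact smul_ne_zero (Finset.prod_ne_zero_iff.2 fun _ _ => this) hx
      refine ⟨_, mem_nhdsWithin_of_mem_nhds ((continuous_abs.comp (continuous_eval_const
        fun _ => v)).continuousAt.eventually (lt_mem_nhds
          (half_lt_self (abs_pos.2 hfv)))), |f fun _ => v| / 2, by positivity, ?_⟩
      exact fun f' hf' => ⟨v, hv, le_of_lt hf'⟩
  refine ⟨c, hc, fun f hf => ?_⟩
  rcases eq_or_ne f 0 with rfl | hf0
  · exact ⟨0, by simp, by simp⟩
  have hn : 0 < ‖f‖ := norm_pos_iff.2 hf0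
  obtain ⟨v, hv, hcv⟩ := hbound (‖f‖⁻¹ • f) ⟨fun v σ => by simp [hf v σ], by
    simp [norm_smul, hn.ne']⟩
  refine ⟨v, hv, ?_⟩
  rw [smul_apply, smul_eq_mul, abs_mul, abs_of_pos (inv_pos.2 hn),
    ← div_eq_inv_mul, le_div_iff₀ hn] at hcv
  exact hcv

lemma exists_diagonal_bound_le (d l : ℕ) : ∃ c : ℝ, 0 < c ∧ ∀ j ≤ l, ∀ f : E d [×j]→L[ℝ] ℝ,
    (∀ (v : Fin j → E d) (σ : Equiv.Perm (Fin j)), f (fun i => v (σ i)) = f v) →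
    ∃ v : E d, ‖v‖ ≤ 1 ∧ c * ‖f‖ ≤ |f fun _ => v| := by
  induction l with
  | zero =>
    obtain ⟨c, hc, h⟩ := exists_diagonal_bound d 0
    exact ⟨c, hc, fun j hj => by obtain rfl := Nat.le_zero.1 hj; exact h⟩
  | succ l ih =>
    obtain ⟨c, hc, h⟩ := ih
    obtain ⟨c', hc', h'⟩ := exists_diagonal_bound d (l + 1)
    refine ⟨min c c', lt_min hc hc', fun j hj f hf => ?_⟩
    rcases Nat.le_succ_iff.1 hj with hj | rfl
    · obtain ⟨v, hv, hcv⟩ := h j hj f hf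
      exact ⟨v, hv, le_trans (by gcongr; exact min_le_left _ _) hcv⟩
    · obtain ⟨v, hv, hcv⟩ := h' f hf
      exact ⟨v, hv, le_trans (by gcongr; exact min_le_right _ _) hcv⟩

/-! ### Sublevel sets of tame functions for Lebesgue measure. -/

lemma volume_ball_mul {d : ℕ} (x : E d) {r s : ℝ} (hr : 0 < r) (hs : 0 < s) :
    volume (ball x (s * r)) = ENNReal.ofReal (s ^ d) * volume (ball x r) := by
  rw [Measure.addHaar_ball_of_pos _ _ hr, Measure.addHaar_ball_of_pos _ _ (mul_pos hs hr),
    ← mul_assoc, ← ENNReal.ofReal_mul (by positivity), finrank_euclideanSpace_fin, mul_pow]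

/-- The ratio of volumes is exactly `3 ^ d`; the `+ 1` serves the strict inequality. -/
lemma isFedererOn_volume (d : ℕ) (V : Set (E d)) :
    IsFedererOn (volume : Measure (E d)) (3 ^ d + 1) V := by
  refine ⟨by positivity, fun x r _ hr _ => ?_⟩
  have h := volume_ball_mul x (r := r / 3) (s := 3) (by positivity) three_pos
  rw [mul_div_cancel₀ _ (three_ne_zero)] at h
  rw [h, ENNReal.div_lt_iff (Or.inl (by simp; positivity)) (Or.inl ENNReal.ofReal_ne_top),
    mul_comm]
  refine ENNReal.mul_lt_mul_right (measure_ball_pos _ _ (by positivity)).ne'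
    measure_ball_lt_top.ne ?_
  exact (ENNReal.ofReal_lt_ofReal_iff (by positivity)).2 (by linarith)

lemma hasDerivAt_iteratedFDeriv_line {d : ℕ} {g : E d → ℝ} {w v : E d} {t : ℝ} (i : ℕ)
    (h : DifferentiableAt ℝ (iteratedFDeriv ℝ i g) (w + t • v)) :
    HasDerivAt (fun t : ℝ => iteratedFDeriv ℝ i g (w + t • v) fun _ => v)
      (iteratedFDeriv ℝ (i + 1) g (w + t • v) fun _ => v) t := by
  have h1 : HasDerivAt (fun t : ℝ => w + t • v) v t := by
    simpa using ((hasDerivAt_id t).smul_const v).const_add w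
  have h2 := h.hasFDerivAt.comp_hasDerivAt t h1
  have h3 := ((ContinuousMultilinearMap.apply ℝ (fun _ : Fin i => E d) ℝ
    fun _ => v).hasFDerivAt).comp_hasDerivAt t h2
  exact h3

lemma convex_line_preimage {d : ℕ} {Q : Set (E d)} (hQ : Convex ℝ Q) (w v : E d) :
    Convex ℝ {t : ℝ | w + t • v ∈ Q} := by
  intro s hs t ht a b ha hb hab
  have := hQ hs ht ha hb hab
  have h2 : a • (w + s • v) + b • (w + t • v) = w + (a • s + b • t) • v := by
    have h3 : w = (a + b) • w := by rw [hab, one_smul]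
    nth_rw 3 [h3]
    simp only [smul_eq_mul]
    module
  rwa [h2] at this

/-- Near a point where the `j`-th derivative of a tame function has size at least `Γ`, sublevel
sets are small on the lines in some direction. -/
lemma IsTame.volume_sublevel_inter_ball_le {d : ℕ} {l j : ℕ} {K c η r Γ ε : ℝ} {g : E d → ℝ}
    {y z v : E d} (hg : IsTame l K g y r Γ) (hl : 0 < l) (hr : 0 < r) (hΓ : 0 < Γ) (hc : 0 < c)
    (hη : 0 < η) (hKη : K * η ≤ c / 2) (hε : 0 < ε) (hεΓ : 2 * ε / (c * Γ) ≤ 1)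
    (hz : z ∈ ball y r) (hj : j ≤ l) (hv : ‖v‖ ≤ 1)
    (hzv : c * Γ ≤ r ^ j * |iteratedFDeriv ℝ j g z fun _ => v|) :
    volume ({w ∈ ball y r | |g w| < ε} ∩ ball z (η * r)) ≤
      ENNReal.ofReal (2 ^ l * 2 ^ d / η * (2 * ε / (c * Γ)) ^ (1 / l : ℝ)) *
        volume (ball z (η * r)) := by
  set e := 2 * ε / (c * Γ) with he
  have he0 : 0 < e := by positivity
  set q := r * e ^ (1 / l : ℝ) with hq
  have hq0 : 0 < q := by positivity
  -- Multiplying by this sign makes the directional derivative at `z` positive, as the one-variable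
  -- estimate requires.
  set s : ℝ := ((SignType.sign (iteratedFDeriv ℝ j g z fun _ => v) : SignType) : ℝ) with hs
  have hss : s * (iteratedFDeriv ℝ j g z fun _ => v) = |iteratedFDeriv ℝ j g z fun _ => v| :=
    sign_mul_self _
  have hz0 : (iteratedFDeriv ℝ j g z fun _ => v) ≠ 0 := by
    intro h
    rw [h, abs_zero, mul_zero] at hzv
    have : 0 < c * Γ := by positivity
    linarith
  have hs1 : |s| = 1 := by
    have h := congrArg abs hss
    rw [abs_mul, abs_abs] at h
    exact mul_right_cancel₀ (abs_ne_zero.2 hz0) (h.trans (one_mul _).symm)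
  set A' := {w ∈ ball y r | |g w| < ε} ∩ ball z (η * r) with hA'
  have hopen : IsOpen A' :=
    ((hg.analytic.continuousOn.abs.isOpen_inter_preimage isOpen_ball isOpen_Iio)).inter isOpen_ball
  have hslice : ∀ w : E d, volume {t : ℝ | w + t • v ∈ A'} ≤ ENNReal.ofReal (2 ^ (l + 1) * q) := by
    intro w
    have hconv := convex_line_preimage ((convex_ball y r).inter (convex_ball z (η * r))) w v
    have hlam : 0 < c * Γ / (2 * r ^ j) := by positivity
    have hkey := volume_sublevel_le_of_deriv_ge j
      (fun i t => s * iteratedFDeriv ℝ i g (w + t • v) fun _ => v) _ hconv hlam hq0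
      (fun i _ t ht => (hasDerivAt_iteratedFDeriv_line i
        (differentiableAt_iteratedFDeriv isOpen_ball hg.analytic i ht.1)).const_mul s)
      (fun t ht => by
        set w' := w + t • v
        have h1 := norm_iteratedFDeriv_sub_le (M := K * Γ / r ^ (j + 1)) hg.analytic j
          (fun x hx => by
            rw [le_div_iff₀ (by positivity), mul_comm]
            exact hg.upper x hx (j + 1) (by omega)) ht.1 hz
        have h2 : |(iteratedFDeriv ℝ j g w' fun _ => v) - iteratedFDeriv ℝ j g z fun _ => v| ≤
            ‖iteratedFDeriv ℝ j g w' - iteratedFDeriv ℝ j g z‖ := by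
          have := (iteratedFDeriv ℝ j g w' - iteratedFDeriv ℝ j g z).le_opNorm fun _ => v
          refine this.trans (mul_le_of_le_one_right (norm_nonneg _) ?_)
          exact Finset.prod_le_one (fun _ _ => norm_nonneg _) fun _ _ => hv
        have h3 : ‖w' - z‖ ≤ η * r := by
          have := mem_ball.1 ht.2
          rw [dist_eq_norm] at this
          exact this.le
        have hKΓ : 0 ≤ K * Γ / r ^ (j + 1) := by
          have := hg.upper z hz (j + 1) (by omega)
          have h4 : 0 ≤ K * Γ := le_trans (by positivity) this
          positivity
        -- Within distance `η * r` of `z` the `j`-th derivative changes by at most half its lower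
        -- bound, because `K * η ≤ c / 2`.
        have h4 : K * Γ / r ^ (j + 1) * ‖w' - z‖ ≤ c * Γ / (2 * r ^ j) := by
          calc _ ≤ K * Γ / r ^ (j + 1) * (η * r) := by gcongr
            _ = K * η * Γ / r ^ j := by rw [pow_succ]; field_simp
            _ ≤ c / 2 * Γ / r ^ j := by gcongr
            _ = _ := by field_simp
        have h5 : c * Γ / r ^ j ≤ |iteratedFDeriv ℝ j g z fun _ => v| := by
          rw [div_le_iff₀ (by positivity), mul_comm _ (r ^ j)]; exact hzv
        have h6 : c * Γ / r ^ j = 2 * (c * Γ / (2 * r ^ j)) := by field_simp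
        have h7 : |s * ((iteratedFDeriv ℝ j g w' fun _ => v) -
            iteratedFDeriv ℝ j g z fun _ => v)| ≤ c * Γ / (2 * r ^ j) := by
          rw [abs_mul, hs1, one_mul]
          linarith
        have h8 := (abs_le.1 h7).1
        rw [mul_sub, hss] at h8
        change _ ≤ s * iteratedFDeriv ℝ j g w' fun _ => v
        linarith)
    refine (measure_mono ?_).trans (hkey.trans (ENNReal.ofReal_le_ofReal ?_))
    · rintro t ⟨⟨ht1, ht2⟩, ht3⟩
      refine ⟨⟨ht1, ht3⟩, ?_⟩
      simp only [abs_mul, hs1, one_mul, iteratedFDeriv_zero_apply]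
      refine lt_of_lt_of_le ht2 ?_
      -- As `e ≤ 1` and `j ≤ l`, the length `q` chosen for order `l` also suffices for order `j`.
      have h9 : e ≤ (e ^ (1 / l : ℝ)) ^ j := by
        rw [← Real.rpow_natCast, ← Real.rpow_mul he0.le]
        calc e = e ^ (1 : ℝ) := (Real.rpow_one e).symm
          _ ≤ _ := Real.rpow_le_rpow_of_exponent_ge he0 hεΓ (by
            have : (j : ℝ) ≤ l := by exact_mod_cast hj
            have h0 : (0 : ℝ) < l := by exact_mod_cast hl
            rw [div_mul_eq_mul_div, one_mul]
            exact (div_le_one h0).2 this)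
      calc ε = c * Γ / 2 * e := by rw [he]; field_simp
        _ ≤ c * Γ / 2 * (e ^ (1 / l : ℝ)) ^ j := by gcongr
        _ = _ := by rw [hq, mul_pow]; field_simp
    · have : (2 : ℝ) ^ (j + 1) ≤ 2 ^ (l + 1) := pow_le_pow_right₀ one_le_two (by omega)
      gcongr
      linarith
  have hfin := volume_le_of_slices hopen.measurableSet (z := z) (v := v) (ρ := η * r)
    (by positivity) (fun w hw => hw.2) hv hslice
  rw [volume_ball_mul z (by positivity) two_pos, ← mul_assoc (ENNReal.ofReal (2 ^ (l + 1) * q)),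
    ← ENNReal.ofReal_mul (by positivity)] at hfin
  have h2ρ : ENNReal.ofReal (2 * (η * r)) ≠ 0 := by simp; positivity
  rw [← ENNReal.mul_le_mul_iff_right h2ρ ENNReal.ofReal_ne_top]
  refine hfin.trans_eq ?_
  rw [← mul_assoc (ENNReal.ofReal (2 * (η * r))), ← ENNReal.ofReal_mul (by positivity), hq]
  congr 2
  field_simp
  ring

/-- Sublevel sets of tame functions have small Lebesgue measure. -/
theorem IsTame.volume_sublevel_le (d : ℕ) {l : ℕ} (hl : 0 < l) {K : ℝ} (hK : 0 ≤ K) :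
    ∃ C : ℝ, 0 < C ∧ ∀ (g : E d → ℝ) (y : E d) (r Γ ε : ℝ), IsTame l K g y r Γ → 0 < r →
      0 < Γ → 0 < ε → volume {w ∈ ball y r | |g w| < ε} ≤
        ENNReal.ofReal (C * (ε / Γ) ^ (1 / l : ℝ)) * volume (ball y r) := by
  obtain ⟨c, hc, hdiag⟩ := exists_diagonal_bound_le d l
  set η := c / (2 * (K + c + 1)) with hη
  have hη0 : 0 < η := by positivity
  have hη1 : η ≤ 1 := by rw [hη, div_le_one (by positivity)]; linarith
  have hKη : K * η ≤ c / 2 := by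
    rw [hη, mul_div_assoc', div_le_div_iff₀ (by positivity) (by positivity)]
    nlinarith
  set C₁ : ℝ := 2 ^ l * 2 ^ d / η * (3 ^ d + 1) ^ 2 with hC₁
  have hC₁0 : 0 < C₁ := by positivity
  refine ⟨(C₁ + 1) * (2 / c) ^ (1 / l : ℝ), by positivity, fun g y r Γ ε hg hr hΓ hε => ?_⟩
  set e := 2 * ε / (c * Γ) with he
  have he0 : 0 < e := by positivity
  have hmul : (C₁ + 1) * (2 / c) ^ (1 / l : ℝ) * (ε / Γ) ^ (1 / l : ℝ) =
      (C₁ + 1) * e ^ (1 / l : ℝ) := by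
    rw [mul_assoc, ← Real.mul_rpow (by positivity) (by positivity), div_mul_div_comm]
  rw [hmul]
  rcases le_or_gt e 1 with he1 | he1
  · have hfed := isFedererOn_volume d univ
    have := hfed.measure_le_of_local_bound (A := {w ∈ ball y r | |g w| < ε}) (y := y) (r := r)
      (ρ := η * r) (θ := ENNReal.ofReal (2 ^ l * 2 ^ d / η * e ^ (1 / l : ℝ)))
      (by simp [Measure.support_eq_univ]) (by positivity) (mul_le_of_le_one_left hr.le hη1)
      (subset_univ _) (fun w hw => hw.1) (fun z hz => by
        obtain ⟨j, hj, hjΓ⟩ := hg.lower z hz.1.1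
        obtain ⟨v, hv, hcv⟩ := hdiag j hj (iteratedFDeriv ℝ j g z) fun v σ =>
          (hg.analytic z hz.1.1).contDiffAt.iteratedFDeriv_comp_perm v σ
        refine hg.volume_sublevel_inter_ball_le hl hr hΓ hc hη0 hKη hε he1 hz.1.1 hj hv ?_
        calc c * Γ ≤ c * (r ^ j * ‖iteratedFDeriv ℝ j g z‖) := by gcongr
          _ = r ^ j * (c * ‖iteratedFDeriv ℝ j g z‖) := by ring
          _ ≤ _ := by gcongr)
    refine this.trans ?_
    gcongr
    rw [← ENNReal.ofReal_pow (by positivity), ← ENNReal.ofReal_mul (by positivity)]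
    refine ENNReal.ofReal_le_ofReal ?_
    have h0 : 0 ≤ e ^ (1 / l : ℝ) := by positivity
    rw [hC₁]
    nlinarith
  -- For `e > 1` the right-hand side exceeds the measure of the whole ball; this is the purpose of
  -- the `+ 1` in the constant.
  · refine (measure_mono fun w hw => hw.1).trans ?_
    refine le_mul_of_one_le_left zero_le ?_
    rw [ENNReal.one_le_ofReal]
    have := Real.one_le_rpow he1.le (z := (1 / l : ℝ)) (by positivity)
    nlinarith

/-! ### Uniform tameness of finite-dimensional analytic families. -/

lemma iteratedFDeriv_linearCombination {d n : ℕ} {b : Fin n → E d → ℝ} {V : Set (E d)}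
    (hb : ∀ i, AnalyticOnNhd ℝ (b i) V) (c : Fin n → ℝ) (j : ℕ) {z : E d} (hz : z ∈ V) :
    iteratedFDeriv ℝ j (∑ i, c i • b i) z = ∑ i, c i • iteratedFDeriv ℝ j (b i) z := by
  rw [iteratedFDeriv_sum_apply (f := fun i => c i • b i)
    fun i _ => ((hb i z hz).contDiffAt (n := j)).const_smul (c i)]
  exact Finset.sum_congr rfl fun i _ => iteratedFDeriv_const_smul_apply (hb i z hz).contDiffAt

/-- In a finite-dimensional space of analytic functions whose `l`-jets at `x₀` are injective, the
derivatives of order `l + 1` are uniformly controlled by the `l`-jets, near `x₀`. -/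
lemma exists_jet_bound {d l : ℕ} {V : Set (E d)} (hV : IsOpen V)
    (F : Submodule ℝ (E d → ℝ)) [FiniteDimensional ℝ F]
    (hF : ∀ g ∈ F, AnalyticOnNhd ℝ g V) {x₀ : E d} (hx₀ : x₀ ∈ V)
    (hjet : ∀ g ∈ F, (∀ j ≤ l, iteratedFDeriv ℝ j g x₀ = 0) → g = 0) :
    ∃ R M : ℝ, 0 < R ∧ R ≤ 1 ∧ 0 ≤ M ∧ ball x₀ R ⊆ V ∧ ∀ g ∈ F, ∀ z ∈ ball x₀ R,
      ∀ z' ∈ ball x₀ R,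
        ‖iteratedFDeriv ℝ (l + 1) g z‖ ≤
          M * ∑ j ∈ Finset.range (l + 1), ‖iteratedFDeriv ℝ j g z'‖ ∧
        (g ≠ 0 → 0 < ∑ j ∈ Finset.range (l + 1), ‖iteratedFDeriv ℝ j g z'‖) := by
  set n := Module.finrank ℝ F
  set b := Module.finBasis ℝ F
  have hb : ∀ i, AnalyticOnNhd ℝ (b i : E d → ℝ) V := fun i => hF _ (b i).2
  have hsum : ∀ g : F, (g : E d → ℝ) = ∑ i, b.repr g i • (b i : E d → ℝ) := fun g => by
    calc (g : E d → ℝ) = ((∑ i, b.repr g i • b i : F) : E d → ℝ) := by rw [b.sum_repr]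
      _ = _ := by rw [Submodule.coe_sum]; rfl
  -- `T` sends coefficients to the `l`-jet at `x₀`. Being injective in finite dimension it is
  -- antilipschitz, so the jet at `x₀` controls the coefficients.
  set T : (Fin n → ℝ) →ₗ[ℝ] ((j : Fin (l + 1)) → E d [×(j : ℕ)]→L[ℝ] ℝ) :=
    LinearMap.pi fun j => Fintype.linearCombination ℝ fun i => iteratedFDeriv ℝ j (b i) x₀ with hT
  have hTapp : ∀ c j, T c j = iteratedFDeriv ℝ j (∑ i, c i • (b i : E d → ℝ)) x₀ := fun c j => by
    rw [iteratedFDeriv_linearCombination hb c j hx₀]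
    simp [hT, Fintype.linearCombination_apply]
    rfl
  have hker : LinearMap.ker T = ⊥ := by
    rw [LinearMap.ker_eq_bot']
    intro c hc
    have h1 : ((∑ i, c i • b i : F) : E d → ℝ) = 0 := by
      refine hjet _ (∑ i, c i • b i : F).2 fun j hj => ?_
      have := congrFun hc ⟨j, Nat.lt_succ_of_le hj⟩
      rw [hTapp] at this
      simpa using this
    have h2 : (∑ i, c i • b i : F) = 0 := Subtype.ext h1
    exact funext (Fintype.linearIndependent_iff.1 b.linearIndependent c h2)
  obtain ⟨κ, hκ, hanti⟩ := T.exists_antilipschitzWith hker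
  have hκ0 : (0 : ℝ) < κ := by exact_mod_cast hκ
  have hcT : ∀ c, ‖c‖ ≤ κ * ‖T c‖ := fun c => by
    simpa using hanti.le_mul_dist c 0
  have hcont : ∀ j i, ContinuousAt (iteratedFDeriv ℝ j (b i : E d → ℝ)) x₀ := fun j i =>
    ((hb i).iteratedFDeriv_of_isOpen hV j x₀ hx₀).continuousAt
  -- Moving the base point perturbs the jet map by less than `1 / (2 * κ)`, which is absorbed and
  -- leaves `‖c‖ ≤ 2 κ S` at nearby points.
  have herr : ∀ᶠ z in nhds x₀, ∑ j ∈ Finset.range (l + 1), ∑ i,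
      ‖iteratedFDeriv ℝ j (b i : E d → ℝ) z - iteratedFDeriv ℝ j (b i : E d → ℝ) x₀‖ <
        1 / (2 * κ) := by
    have hc : ContinuousAt (fun z => ∑ j ∈ Finset.range (l + 1), ∑ i,
      ‖iteratedFDeriv ℝ j (b i : E d → ℝ) z - iteratedFDeriv ℝ j (b i : E d → ℝ) x₀‖) x₀ :=
      tendsto_finsetSum _ fun j _ => tendsto_finsetSum _ fun i _ =>
        ((hcont j i).sub continuousAt_const).norm
    refine hc.eventually (gt_mem_nhds ?_)
    simp only [sub_self, norm_zero, Finset.sum_const_zero]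
    positivity
  have htop : ∀ᶠ z in nhds x₀, ∑ i, ‖iteratedFDeriv ℝ (l + 1) (b i : E d → ℝ) z‖ <
      ∑ i, ‖iteratedFDeriv ℝ (l + 1) (b i : E d → ℝ) x₀‖ + 1 := by
    have hc : ContinuousAt (fun z => ∑ i, ‖iteratedFDeriv ℝ (l + 1) (b i : E d → ℝ) z‖) x₀ :=
      tendsto_finsetSum _ fun i _ => (hcont (l + 1) i).norm
    exact hc.eventually (gt_mem_nhds (lt_add_one _))
  set M₀ := ∑ i, ‖iteratedFDeriv ℝ (l + 1) (b i : E d → ℝ) x₀‖ + 1 with hM₀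
  have hM₀0 : 0 < M₀ := by positivity
  obtain ⟨R, hR, hball⟩ := Metric.eventually_nhds_iff_ball.1 ((hV.eventually_mem hx₀).and (herr.and htop))
  refine ⟨min R 1, M₀ * (2 * κ), lt_min hR one_pos, min_le_right _ _, by positivity,
    fun z hz => (hball z (ball_subset_ball (min_le_left _ _) hz)).1, fun g hg z hz z' hz' => ?_⟩
  obtain ⟨hzV, -, hz2⟩ := hball z (ball_subset_ball (min_le_left _ _) hz)
  obtain ⟨hzV', hz1', -⟩ := hball z' (ball_subset_ball (min_le_left _ _) hz')
  set c : Fin n → ℝ := ⇑(b.repr ⟨g, hg⟩) with hc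
  have hgc : g = ∑ i, c i • (b i : E d → ℝ) := hsum ⟨g, hg⟩
  set S := ∑ j ∈ Finset.range (l + 1), ‖iteratedFDeriv ℝ j g z'‖ with hS
  have hS0 : 0 ≤ S := Finset.sum_nonneg fun _ _ => norm_nonneg _
  have hcomb : ∀ (j : ℕ) (A : Fin n → E d [×j]→L[ℝ] ℝ), ‖∑ i, c i • A i‖ ≤ ‖c‖ * ∑ i, ‖A i‖ := by
    intro j A
    rw [Finset.mul_sum]
    refine (norm_sum_le _ _).trans (Finset.sum_le_sum fun i _ => ?_)
    rw [norm_smul]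
    gcongr
    exact norm_le_pi_norm c i
  have hup : ‖iteratedFDeriv ℝ (l + 1) g z‖ ≤ ‖c‖ * M₀ := by
    rw [hgc, iteratedFDeriv_linearCombination hb c _ hzV]
    refine (hcomb _ _).trans ?_
    gcongr
  have hlow : ‖c‖ ≤ 2 * κ * S := by
    have h1 : ‖T c‖ ≤ S + ‖c‖ * (1 / (2 * κ)) := by
      calc ‖T c‖ ≤ ∑ j : Fin (l + 1), ‖T c j‖ :=
            (pi_norm_le_iff_of_nonneg (Finset.sum_nonneg fun _ _ => norm_nonneg _)).2 fun j =>
              Finset.single_le_sum (f := fun j => ‖T c j‖) (fun _ _ => norm_nonneg _)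
                (Finset.mem_univ j)
        _ = ∑ j ∈ Finset.range (l + 1), ‖iteratedFDeriv ℝ j g x₀‖ := by
            simp only [hTapp, ← hgc]
            exact Fin.sum_univ_eq_sum_range (fun j => ‖iteratedFDeriv ℝ j g x₀‖) (l + 1)
        _ ≤ ∑ j ∈ Finset.range (l + 1), (‖iteratedFDeriv ℝ j g z'‖ + ‖c‖ * ∑ i,
              ‖iteratedFDeriv ℝ j (b i : E d → ℝ) z' - iteratedFDeriv ℝ j (b i : E d → ℝ) x₀‖) := by
            refine Finset.sum_le_sum fun j _ => ?_
            have h2 : iteratedFDeriv ℝ j g x₀ = iteratedFDeriv ℝ j g z' - ∑ i, c i •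
                (iteratedFDeriv ℝ j (b i : E d → ℝ) z' -
                  iteratedFDeriv ℝ j (b i : E d → ℝ) x₀) := by
              rw [hgc, iteratedFDeriv_linearCombination hb c _ hzV',
                iteratedFDeriv_linearCombination hb c _ hx₀]
              simp only [smul_sub, Finset.sum_sub_distrib]
              exact (sub_sub_cancel _ _).symm
            rw [h2]
            refine (norm_sub_le _ _).trans ?_
            gcongr
            exact hcomb _ _
        _ ≤ _ := by
            rw [Finset.sum_add_distrib, ← Finset.mul_sum]
            gcongr
    have h3 := hcT c
    have h4 : κ * ‖T c‖ ≤ κ * (S + ‖c‖ * (1 / (2 * κ))) := by gcongr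
    have h5 : κ * (S + ‖c‖ * (1 / (2 * κ))) = κ * S + ‖c‖ / 2 := by field_simp
    linarith
  refine ⟨?_, fun hg0 => ?_⟩
  · calc _ ≤ ‖c‖ * M₀ := hup
      _ ≤ 2 * κ * S * M₀ := by gcongr
      _ = _ := by ring
  · by_contra hneg
    have hS' : S = 0 := le_antisymm (not_lt.1 hneg) hS0
    rw [hS', mul_zero] at hlow
    have hc0 : c = 0 := norm_le_zero_iff.1 hlow
    exact hg0 (by rw [hgc, hc0]; simp)

/-- Nonzero functions in a finite-dimensional space of analytic functions whose `l`-jets at `x₀`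
are injective are uniformly tame on all balls close to `x₀`. -/
theorem exists_isTame {d l : ℕ} {V : Set (E d)} (hV : IsOpen V)
    (F : Submodule ℝ (E d → ℝ)) [FiniteDimensional ℝ F]
    (hF : ∀ g ∈ F, AnalyticOnNhd ℝ g V) {x₀ : E d} (hx₀ : x₀ ∈ V)
    (hjet : ∀ g ∈ F, (∀ j ≤ l, iteratedFDeriv ℝ j g x₀ = 0) → g = 0) :
    ∃ R K : ℝ, 0 < R ∧ R ≤ 1 ∧ 0 < K ∧ ball x₀ R ⊆ V ∧ ∀ g ∈ F, g ≠ 0 → ∀ y r, 0 < r → r ≤ 1 →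
      ball y r ⊆ ball x₀ R → ∃ Γ, 0 < Γ ∧ IsTame l K g y r Γ := by
  obtain ⟨R, M, hR, hR1, hM, hRV, hjb⟩ := exists_jet_bound hV F hF hx₀ hjet
  set K₀ := max M 1 with hK₀
  have hK₀1 : 1 ≤ K₀ := le_max_right _ _
  have hK₀0 : 0 < K₀ := by linarith
  set K₁ : ℝ := (l + 1) * (3 ^ (l + 1) * K₀) with hK₁
  have hK₁0 : 0 < K₁ := by positivity
  refine ⟨R, 3 ^ (l + 1) * K₀ * ((l + 1) * K₁), hR, hR1, by positivity, hRV,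
    fun g hg hg0 y r hr hr1 hball => ?_⟩
  have han : AnalyticOnNhd ℝ g (ball y r) := (hF g hg).mono (hball.trans hRV)
  set S : E d → ℝ := fun z => ∑ j ∈ Finset.range (l + 1), r ^ j * ‖iteratedFDeriv ℝ j g z‖ with hS
  have hSj : ∀ z, ∀ j ≤ l, r ^ j * ‖iteratedFDeriv ℝ j g z‖ ≤ S z := fun z j hj =>
    Finset.single_le_sum (f := fun j => r ^ j * ‖iteratedFDeriv ℝ j g z‖)
      (fun _ _ => by positivity) (Finset.mem_range.2 (Nat.lt_succ_of_le hj))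
  have hSlow : ∀ z, r ^ l * ∑ j ∈ Finset.range (l + 1), ‖iteratedFDeriv ℝ j g z‖ ≤ S z := by
    intro z
    rw [Finset.mul_sum]
    refine Finset.sum_le_sum fun j hj => mul_le_mul_of_nonneg_right ?_ (norm_nonneg _)
    exact pow_le_pow_of_le_one hr.le hr1 (Nat.le_of_lt_succ (Finset.mem_range.1 hj))
  have hSpos : ∀ z ∈ ball y r, 0 < S z := fun z hz =>
    lt_of_lt_of_le (mul_pos (by positivity) ((hjb g hg z (hball hz) z (hball hz)).2 hg0)) (hSlow z)
  -- Descending induction on the order `l + 1 - i`. The top order is the jet bound, where `r ≤ 1`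
  -- absorbs the rescaling. Below it, the mean value inequality over a distance at most `2 r` adds
  -- twice the previous bound, whence the factor `3` per step.
  have hclaim : ∀ i ≤ l + 1, ∀ z ∈ ball y r, ∀ z' ∈ ball y r,
      r ^ (l + 1 - i) * ‖iteratedFDeriv ℝ (l + 1 - i) g z‖ ≤ 3 ^ i * K₀ * S z' := by
    intro i
    induction i with
    | zero =>
      intro _ z hz z' hz'
      have h1 := (hjb g hg z (hball hz) z' (hball hz')).1
      have hnn : 0 ≤ ∑ j ∈ Finset.range (l + 1), ‖iteratedFDeriv ℝ j g z'‖ :=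
        Finset.sum_nonneg fun _ _ => norm_nonneg _
      calc r ^ (l + 1) * ‖iteratedFDeriv ℝ (l + 1) g z‖
          ≤ r ^ (l + 1) * (M * ∑ j ∈ Finset.range (l + 1), ‖iteratedFDeriv ℝ j g z'‖) := by gcongr
        _ = r * M * (r ^ l * ∑ j ∈ Finset.range (l + 1), ‖iteratedFDeriv ℝ j g z'‖) := by ring
        _ ≤ 1 * K₀ * S z' := by
            gcongr
            · exact le_max_left _ _
            · exact hSlow z'
        _ = _ := by ring
    | succ i ih =>
      intro hi z hz z' hz'
      obtain ⟨j, hj⟩ : ∃ j, l + 1 - (i + 1) = j := ⟨_, rfl⟩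
      have hj1 : l + 1 - i = j + 1 := by omega
      rw [hj]
      rw [hj1] at ih
      have hz'S := hSpos z' hz'
      have h1 := norm_iteratedFDeriv_sub_le (M := 3 ^ i * K₀ * S z' / r ^ (j + 1)) han j
        (fun x hx => by
          rw [le_div_iff₀ (by positivity), mul_comm]
          exact ih (by omega) x hx z' hz') hz hz'
      have h2 : ‖z - z'‖ ≤ 2 * r := by
        rw [← dist_eq_norm]
        have := dist_triangle_right z z' y
        have h3 := mem_ball.1 hz
        have h4 := mem_ball.1 hz'
        linarith
      have h3 : ‖iteratedFDeriv ℝ j g z‖ ≤ ‖iteratedFDeriv ℝ j g z'‖ +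
          3 ^ i * K₀ * S z' / r ^ (j + 1) * (2 * r) := by
        have h4 := norm_le_norm_add_norm_sub (iteratedFDeriv ℝ j g z') (iteratedFDeriv ℝ j g z)
        refine h4.trans ?_
        rw [norm_sub_rev]
        gcongr
        exact h1.trans (by gcongr)
      calc r ^ j * ‖iteratedFDeriv ℝ j g z‖
          ≤ r ^ j * (‖iteratedFDeriv ℝ j g z'‖ + 3 ^ i * K₀ * S z' / r ^ (j + 1) * (2 * r)) := by
            gcongr
        _ = r ^ j * ‖iteratedFDeriv ℝ j g z'‖ + 2 * (3 ^ i * K₀ * S z') := by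
            rw [pow_succ]; field_simp
        _ ≤ 1 * S z' + 2 * (3 ^ i * K₀ * S z') := by
            rw [one_mul]
            gcongr
            exact hSj z' j (by omega)
        _ ≤ 3 ^ i * K₀ * S z' + 2 * (3 ^ i * K₀ * S z') := by
            gcongr
            exact one_le_mul_of_one_le_of_one_le (one_le_pow₀ (by norm_num)) hK₀1
        _ = _ := by ring
  have hupper : ∀ z ∈ ball y r, ∀ z' ∈ ball y r, ∀ j ≤ l + 1,
      r ^ j * ‖iteratedFDeriv ℝ j g z‖ ≤ 3 ^ (l + 1) * K₀ * S z' := by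
    intro z hz z' hz' j hj
    have h := hclaim (l + 1 - j) (by omega) z hz z' hz'
    rw [Nat.sub_sub_self hj] at h
    have := hSpos z' hz'
    refine h.trans ?_
    gcongr
    · norm_num
    · omega
  have hcomp : ∀ z ∈ ball y r, ∀ z' ∈ ball y r, S z ≤ K₁ * S z' := by
    intro z hz z' hz'
    calc S z ≤ ∑ j ∈ Finset.range (l + 1), 3 ^ (l + 1) * K₀ * S z' :=
          Finset.sum_le_sum fun j hj => hupper z hz z' hz' j (Finset.mem_range.1 hj).le
      _ = _ := by
          rw [Finset.sum_const, Finset.card_range, nsmul_eq_mul, hK₁]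
          push_cast
          ring
  have hy : y ∈ ball y r := mem_ball_self hr
  have hSy := hSpos y hy
  -- The rescaled jet sizes `S` at different points are comparable up to `K₁`, and some summand of
  -- `S z` is at least its average; these two losses determine `Γ`.
  refine ⟨S y / ((l + 1) * K₁), by positivity, han, fun z hz j hj => ?_, fun z hz => ?_⟩
  · rw [mul_assoc, mul_div_cancel₀ _ (by positivity)]
    exact hupper z hz y hy j hj
  · obtain ⟨j, hj, hjS⟩ := Finset.exists_le_of_sum_le (s := Finset.range (l + 1))
      (f := fun _ => S z / (l + 1)) (g := fun j => r ^ j * ‖iteratedFDeriv ℝ j g z‖) (by simp) (by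
        rw [Finset.sum_const, Finset.card_range, nsmul_eq_mul]
        push_cast
        rw [mul_div_cancel₀ _ (by positivity)])
    refine ⟨j, Nat.le_of_lt_succ (Finset.mem_range.1 hj), le_trans ?_ hjS⟩
    rw [div_le_div_iff₀ (by positivity) (by positivity)]
    have := hcomp y hy z hz
    calc S y * (l + 1) ≤ K₁ * S z * (l + 1) := by gcongr
      _ = _ := by ring

/-! ### Generalized Wronskians and generic injectivity of jets. -/

/-- The mixed directional derivative of `g` in the directions listed by `q`. -/
noncomputable def jetEntry {d : ℕ} (q : Σ n : ℕ, Fin n → E d) (g : E d → ℝ) (x : E d) : ℝ :=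
  iteratedFDeriv ℝ q.1 g x q.2

lemma analyticOnNhd_jetEntry {d : ℕ} {V : Set (E d)} (hV : IsOpen V) {g : E d → ℝ}
    (hg : AnalyticOnNhd ℝ g V) (q : Σ n : ℕ, Fin n → E d) :
    AnalyticOnNhd ℝ (jetEntry q g) V := fun x hx =>
  (ContinuousMultilinearMap.apply ℝ (fun _ : Fin q.1 => E d) ℝ q.2).analyticAt _ |>.comp
    (hg.iteratedFDeriv_of_isOpen hV q.1 x hx)

lemma fderiv_jetEntry {d : ℕ} {V : Set (E d)} (hV : IsOpen V) {g : E d → ℝ}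
    (hg : AnalyticOnNhd ℝ g V) (q : Σ n : ℕ, Fin n → E d) {x : E d} (hx : x ∈ V) (w : E d) :
    fderiv ℝ (jetEntry q g) x w = jetEntry ⟨q.1 + 1, Fin.cons w q.2⟩ g x := by
  have h1 := (differentiableAt_iteratedFDeriv hV hg q.1 hx).hasFDerivAt
  have h2 := (ContinuousMultilinearMap.apply ℝ (fun _ : Fin q.1 => E d) ℝ
    q.2).hasFDerivAt.comp x h1
  have h3 : fderiv ℝ (jetEntry q g) x = _ := h2.fderiv
  rw [h3, jetEntry, iteratedFDeriv_succ_apply_left]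
  simp

lemma analyticAt_det {d n : ℕ} {M : E d → Matrix (Fin n) (Fin n) ℝ} {x : E d}
    (h : ∀ i j, AnalyticAt ℝ (fun y => M y i j) x) : AnalyticAt ℝ (fun y => (M y).det) x := by
  simp only [Matrix.det_apply']
  exact Finset.analyticAt_fun_sum _ fun σ _ =>
    analyticAt_const.mul (Finset.analyticAt_fun_prod _ fun i _ => h _ _)

/-- The unique solution of a square linear system with analytic coefficients is analytic. -/
lemma exists_analyticAt_solution {d n : ℕ} {M : E d → Matrix (Fin n) (Fin n) ℝ}
    {B : E d → Fin n → ℝ} {O : Set (E d)} (hM : ∀ i j, AnalyticOnNhd ℝ (fun y => M y i j) O)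
    (hB : ∀ i, AnalyticOnNhd ℝ (fun y => B y i) O) (hdet : ∀ x ∈ O, (M x).det ≠ 0) :
    ∃ c : Fin n → E d → ℝ, (∀ j, AnalyticOnNhd ℝ (c j) O) ∧
      ∀ x ∈ O, ∀ i, ∑ j, M x i j * c j x = B x i := by
  refine ⟨fun j x => ((M x).updateCol j (B x)).det / (M x).det, fun j x hx => ?_,
    fun x hx i => ?_⟩
  · refine (analyticAt_det fun i k => ?_).div (analyticAt_det fun i k => hM i k x hx) (hdet x hx)
    simp only [Matrix.updateCol_apply]
    split_ifs
    · exact hB i x hx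
    · exact hM i k x hx
  · have h := congrFun (Matrix.mulVec_cramer (M x) (B x)) i
    simp only [Matrix.mulVec, dotProduct, Matrix.cramer_apply, Pi.smul_apply, smul_eq_mul] at h
    simp only [← mul_div_assoc]
    rw [← Finset.sum_div, h, mul_div_cancel_left₀ _ (hdet x hx)]

/-- Linearly independent analytic functions `b 0, …, b (m - 1)` have a generalized Wronskian,
built from derivatives of order less than `m`, that does not vanish identically. -/
theorem exists_wronskian_ne_zero {d : ℕ} {V : Set (E d)} (hV : IsOpen V) (hpre : IsPreconnected V)
    (hne : V.Nonempty) (m : ℕ) (b : Fin m → E d → ℝ) (hb : ∀ i, AnalyticOnNhd ℝ (b i) V)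
    (hli : ∀ c : Fin m → ℝ, (∀ x ∈ V, ∑ i, c i * b i x = 0) → c = 0) :
    ∃ p : Fin m → Σ n : ℕ, Fin n → E d, (∀ i, (p i).1 < m) ∧
      ∃ x ∈ V, (Matrix.of fun i j => jetEntry (p i) (b j) x).det ≠ 0 := by
  induction m with
  | zero =>
    obtain ⟨x, hx⟩ := hne
    exact ⟨fun i => i.elim0, fun i => i.elim0, x, hx, by simp⟩
  | succ m ih =>
    obtain ⟨p, hp, x₀, hx₀, hdet⟩ := ih (fun i => b i.castSucc) (fun i => hb _) fun c hc => by
      have h := hli (Fin.snoc c 0) fun x hx => by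
        rw [Fin.sum_univ_castSucc]
        simpa using hc x hx
      ext i
      simpa using congrFun h i.castSucc
    by_contra hcon
    push Not at hcon
    set M : E d → Matrix (Fin m) (Fin m) ℝ :=
      fun x => Matrix.of fun i j => jetEntry (p i) (b j.castSucc) x with hM
    have hMan : ∀ i j, AnalyticOnNhd ℝ (fun x => M x i j) V := fun i j =>
      analyticOnNhd_jetEntry hV (hb _) (p i)
    set O : Set (E d) := V ∩ (fun x => (M x).det) ⁻¹' {0}ᶜ with hO
    have hOV : O ⊆ V := inter_subset_left
    have hOopen : IsOpen O := by
      have : ContinuousOn (fun x => (M x).det) V := fun x hx =>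
        (analyticAt_det fun i j => hMan i j x hx).continuousAt.continuousWithinAt
      exact this.isOpen_inter_preimage hV isOpen_compl_singleton
    obtain ⟨c, hcan, hc⟩ := exists_analyticAt_solution (M := M) (O := O)
      (B := fun x i => jetEntry (p i) (b (Fin.last m)) x) (fun i j => (hMan i j).mono hOV)
      (fun i => (analyticOnNhd_jetEntry hV (hb _) (p i)).mono hOV) fun x hx => hx.2
    have hinj : ∀ x ∈ O, ∀ w : Fin m → ℝ, (∀ i, ∑ j, M x i j * w j = 0) → w = 0 := by
      intro x hx w hw
      by_contra hw0
      exact hx.2 (Matrix.exists_mulVec_eq_zero_iff.1 ⟨w, hw0, funext hw⟩)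
    -- Bordering the invertible matrix `M x` by any row `q` of order at most `m` gives a singular
    -- matrix, so the coefficients `c`, determined by the rows `p i`, satisfy the relation for row
    -- `q` as well.
    have hall : ∀ x ∈ O, ∀ q : Σ n : ℕ, Fin n → E d, q.1 ≤ m →
        jetEntry q (b (Fin.last m)) x = ∑ j, jetEntry q (b j.castSucc) x * c j x := by
      intro x hx q hq
      have hd := hcon (Fin.snoc p q) (fun i => by
        refine Fin.lastCases ?_ (fun i => ?_) i
        · simpa using Nat.lt_succ_of_le hq
        · simpa using (hp i).trans (Nat.lt_succ_self m)) x hx.1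
      obtain ⟨w, hw0, hw⟩ := Matrix.exists_mulVec_eq_zero_iff.2 hd
      have hrow : ∀ i : Fin m, ∑ j, M x i j * w j.castSucc +
          jetEntry (p i) (b (Fin.last m)) x * w (Fin.last m) = 0 := fun i => by
        have := congrFun hw i.castSucc
        simpa [Matrix.mulVec, dotProduct, Fin.sum_univ_castSucc, hM] using this
      have hlast : ∑ j : Fin m, jetEntry q (b j.castSucc) x * w j.castSucc +
          jetEntry q (b (Fin.last m)) x * w (Fin.last m) = 0 := by
        have := congrFun hw (Fin.last m)
        simpa [Matrix.mulVec, dotProduct, Fin.sum_univ_castSucc] using this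
      have hsol : (fun j : Fin m => w j.castSucc + c j x * w (Fin.last m)) = 0 := by
        refine hinj x hx _ fun i => ?_
        rw [← hrow i, ← hc x hx i, Finset.sum_mul, ← Finset.sum_add_distrib]
        exact Finset.sum_congr rfl fun j _ => by ring
      have hwj : ∀ j : Fin m, w j.castSucc = -(c j x * w (Fin.last m)) := fun j =>
        eq_neg_of_add_eq_zero_left (congrFun hsol j)
      have hwl : w (Fin.last m) ≠ 0 := by
        intro h0
        refine hw0 (funext fun i => ?_)
        refine Fin.lastCases ?_ (fun i => ?_) i
        · exact h0
        · simp [hwj, h0]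
      refine mul_right_cancel₀ hwl ?_
      rw [Finset.sum_mul, eq_neg_of_add_eq_zero_right hlast, ← Finset.sum_neg_distrib]
      exact Finset.sum_congr rfl fun j _ => by rw [hwj]; ring
    -- Differentiate the relation for row `p i`. The derivative of that row has order at most `m`,
    -- so it satisfies the relation too; subtracting leaves `M x` applied to the derivatives of the
    -- `c j`, which must vanish.
    have hder : ∀ x ∈ O, ∀ j, fderiv ℝ (c j) x = 0 := by
      intro x hx j
      ext v
      refine congrFun (hinj x hx (fun j => fderiv ℝ (c j) x v) fun i => ?_) j
      have hd1 : ∀ j, DifferentiableAt ℝ (jetEntry (p i) (b j)) x := fun j =>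
        (analyticOnNhd_jetEntry hV (hb j) (p i) x hx.1).differentiableAt
      have hd2 : ∀ j, DifferentiableAt ℝ (c j) x := fun j => (hcan j x hx).differentiableAt
      have heq : jetEntry (p i) (b (Fin.last m)) =ᶠ[nhds x]
          fun y => ∑ j, jetEntry (p i) (b (Fin.castSucc j)) y * c j y :=
        Filter.eventually_of_mem (hOopen.mem_nhds hx) fun y hy => hall y hy (p i) (hp i).le
      have h1 : fderiv ℝ (jetEntry (p i) (b (Fin.last m))) x v = ∑ j : Fin m,
          (jetEntry (p i) (b j.castSucc) x * fderiv ℝ (c j) x v +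
            c j x * fderiv ℝ (jetEntry (p i) (b j.castSucc)) x v) := by
        rw [heq.fderiv_eq, fderiv_fun_sum (A := fun j y => jetEntry (p i) (b (Fin.castSucc j)) y *
          c j y) fun j _ => (hd1 _).mul (hd2 j), sum_apply]
        exact Finset.sum_congr rfl fun j _ => by
          rw [fderiv_fun_mul (hd1 _) (hd2 j)]
          simp
      rw [fderiv_jetEntry hV (hb _) _ hx.1, hall x hx ⟨(p i).1 + 1, Fin.cons v (p i).2⟩ (hp i),
        Finset.sum_add_distrib] at h1
      simp only [fderiv_jetEntry hV (hb _) _ hx.1] at h1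
      have h2 : ∑ j : Fin m, c j x * jetEntry ⟨(p i).1 + 1, Fin.cons v (p i).2⟩ (b j.castSucc) x =
          ∑ j : Fin m, jetEntry ⟨(p i).1 + 1, Fin.cons v (p i).2⟩ (b j.castSucc) x * c j x :=
        Finset.sum_congr rfl fun j _ => mul_comm _ _
      rw [h2] at h1
      simpa [hM] using h1
    obtain ⟨r, hr, hball⟩ := Metric.isOpen_iff.1 hOopen x₀ ⟨hx₀, hdet⟩
    have hconst : ∀ x ∈ ball x₀ r, ∀ j, c j x = c j x₀ := by
      intro x hx j
      have := (convex_ball x₀ r).norm_image_sub_le_of_norm_fderiv_le (𝕜 := ℝ) (f := c j) (C := 0)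
        (fun y hy => (hcan j y (hball hy)).differentiableAt)
        (fun y hy => by rw [hder y (hball hy) j, norm_zero]) (mem_ball_self hr) hx
      rw [zero_mul] at this
      exact sub_eq_zero.1 (norm_le_zero_iff.1 this)
    -- With `c` constant near `x₀`, the relation of order zero is a linear dependence there, and the
    -- identity theorem spreads it to `V`.
    have hzero : EqOn (fun x => b (Fin.last m) x - ∑ j : Fin m, c j x₀ * b j.castSucc x) 0 V := by
      refine AnalyticOnNhd.eqOn_zero_of_preconnected_of_eventuallyEq_zero (𝕜 := ℝ) (z₀ := x₀) (fun x hx => ?_)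
        hpre hx₀ ?_
      · exact (hb _ x hx).sub (Finset.analyticAt_fun_sum _ fun j _ =>
          analyticAt_const.mul (hb _ x hx))
      · refine Filter.eventually_of_mem (ball_mem_nhds x₀ hr) fun x hx => ?_
        have := hall x (hball hx) ⟨0, Fin.elim0⟩ (Nat.zero_le _)
        simp only [jetEntry, iteratedFDeriv_zero_apply] at this
        simp only [Pi.zero_apply, this, sub_eq_zero]
        exact Finset.sum_congr rfl fun j _ => by rw [hconst x hx j]; ring
    have hfin := hli (Fin.snoc (fun j => -c j x₀) 1) fun x hx => by
      have := hzero hx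
      simp only [Pi.zero_apply] at this
      rw [Fin.sum_univ_castSucc]
      simp only [Fin.snoc_castSucc, Fin.snoc_last, neg_mul, Finset.sum_neg_distrib]
      linarith
    simpa using congrFun hfin (Fin.last m)

/-- At generic points, the jets of order less than `dim F` are injective on a finite-dimensional
space `F` of analytic functions. -/
theorem exists_generic_jet_injective {d : ℕ} {V : Set (E d)} (hV : IsOpen V)
    (hpre : IsPreconnected V) (hne : V.Nonempty) (F : Submodule ℝ (E d → ℝ))
    [FiniteDimensional ℝ F] (hF : ∀ g ∈ F, AnalyticOnNhd ℝ g V)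
    (hzero : ∀ g ∈ F, (∀ x ∈ V, g x = 0) → g = 0) :
    ∃ W : E d → ℝ, AnalyticOnNhd ℝ W V ∧ (∃ x ∈ V, W x ≠ 0) ∧ ∀ x ∈ V, W x ≠ 0 → ∀ g ∈ F,
      (∀ j < Module.finrank ℝ F, iteratedFDeriv ℝ j g x = 0) → g = 0 := by
  have hb : ∀ i, AnalyticOnNhd ℝ (Module.finBasis ℝ F i : E d → ℝ) V := fun i =>
    hF _ (Module.finBasis ℝ F i).2
  obtain ⟨p, hp, x₀, hx₀, hdet⟩ := exists_wronskian_ne_zero hV hpre hne (Module.finrank ℝ F)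
    (fun i => (Module.finBasis ℝ F i : E d → ℝ)) hb fun c hc => by
      have h1 : ((∑ i, c i • Module.finBasis ℝ F i : F) : E d → ℝ) = 0 := by
        refine hzero _ (Subtype.mem _) fun x hx => ?_
        rw [← hc x hx, Submodule.coe_sum, Finset.sum_apply]
        rfl
      exact funext (Fintype.linearIndependent_iff.1 (Module.finBasis ℝ F).linearIndependent c
        (Subtype.ext h1))
  refine ⟨fun x => (Matrix.of fun i j => jetEntry (p i)
    (Module.finBasis ℝ F j : E d → ℝ) x).det, fun x hx => analyticAt_det fun i j =>
      analyticOnNhd_jetEntry hV (hb j) (p i) x hx, ⟨x₀, hx₀, hdet⟩, fun x hx hWx g hg hj => ?_⟩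
  set c : Fin (Module.finrank ℝ F) → ℝ := ⇑((Module.finBasis ℝ F).repr ⟨g, hg⟩) with hc
  have hgc : g = ∑ i, c i • (Module.finBasis ℝ F i : E d → ℝ) := by
    calc g = ((∑ i, c i • Module.finBasis ℝ F i : F) : E d → ℝ) := by
          rw [hc, (Module.finBasis ℝ F).sum_repr]
      _ = _ := by rw [Submodule.coe_sum]; rfl
  have hc0 : c = 0 := by
    by_contra hc0
    refine hWx (Matrix.exists_mulVec_eq_zero_iff.1 ⟨c, hc0, funext fun i => ?_⟩)
    have h1 := hj _ (hp i)
    rw [hgc, iteratedFDeriv_linearCombination hb c _ hx] at h1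
    have h2 := congrArg (fun f => f (p i).2) h1
    simp only [sum_apply, smul_apply, zero_apply, smul_eq_mul] at h2
    simp only [Matrix.mulVec, dotProduct, Matrix.of_apply, jetEntry, Pi.zero_apply]
    rw [← h2]
    exact Finset.sum_congr rfl fun j _ => mul_comm _ _
  rw [hgc, hc0]
  simp

/-! ### Counting partitions and the dimension of the space of symmetric polynomials. -/

section Count

variable {τ k : ℕ}

instance finite_partitions (τ k : ℕ) :
    Finite {l : Fin τ → ℕ // Antitone l ∧ ∑ i, l i ≤ k} := by
  refine Finite.of_injective (β := Fin τ → Fin (k + 1)) (fun l i => ⟨l.1 i, Nat.lt_succ_of_le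
    ((Finset.single_le_sum (fun _ _ => Nat.zero_le _) (Finset.mem_univ i)).trans l.2.2)⟩) ?_
  intro l l' h
  ext i
  simpa using congrFun h i

/-- The partitions `0` and `(1, 0, …, 0)` are both counted. This gives `N - 1 > 0`, so that the
exponents are positive. -/
lemma two_le_schurCount (hτ : 0 < τ) (hk : 0 < k) : 2 ≤ schurCount τ k := by
  have : NeZero τ := ⟨hτ.ne'⟩
  have hs : ∑ i : Fin τ, (Pi.single 0 1 : Fin τ → ℕ) i = 1 := by simp
  refine Finite.one_lt_card_iff_nontrivial.2 ⟨⟨0, antitone_const, by simp⟩,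
    ⟨Pi.single 0 1, fun i j hij => ?_, by rw [hs]; exact hk⟩, fun h => ?_⟩
  · rcases eq_or_ne j 0 with rfl | hj
    · rw [le_antisymm hij (Fin.zero_le i)]
    · simp [Pi.single_eq_of_ne hj]
  · have := congrFun (congrArg Subtype.val h) 0
    simp at this

lemma ofFn_coe_injective {α : Type*} [PartialOrder α] {n : ℕ} {f g : Fin n → α} (hf : Antitone f)
    (hg : Antitone g) (h : (List.ofFn f : Multiset α) = List.ofFn g) : f = g :=
  List.ofFn_injective ((Multiset.coe_eq_coe.1 h).eq_of_pairwise'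
    hf.sortedGE_ofFn.pairwise hg.sortedGE_ofFn.pairwise)

/-- The binomial coefficient counts multisets of size `τ` in `Fin k`. A partition with all parts
below `k` is such a multiset. The only other one, `(k, 0, …, 0)`, is sent to the constant multiset
with value `k - 1`, which is not taken because `τ (k - 1) > k` outside the excluded case. -/
lemma schurCount_le_choose (hτ : 2 ≤ τ) (hk : 2 ≤ k) (h22 : ¬(τ = 2 ∧ k = 2)) :
    schurCount τ k ≤ (k + τ - 1).choose τ := by
  classical
  have hcard : Nat.card (Sym (Fin k) τ) = (k + τ - 1).choose τ := by
    rw [Nat.card_eq_fintype_card, Sym.card_sym_eq_multichoose, Fintype.card_fin, Nat.multichoose_eq]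
  rw [← hcard, schurCount]
  set φ : (Fin τ → ℕ) → Fin τ → Fin k := fun l =>
    if h : ∀ i, l i < k then fun i => ⟨l i, h i⟩ else fun _ => ⟨k - 1, by omega⟩ with hφ
  have hφanti : ∀ l, Antitone l → Antitone (φ l) := by
    intro l hl
    simp only [hφ]
    split_ifs with h
    · exact fun i j hij => hl hij
    · exact antitone_const
  have hlarge : τ * (k - 1) > k := by
    obtain ⟨k, rfl⟩ := Nat.exists_eq_add_of_le hk
    rcases Nat.eq_zero_or_pos k with rfl | hk0
    · have : τ ≠ 2 := fun h => h22 ⟨h, rfl⟩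
      simp only [add_zero, Nat.reduceSub, mul_one]
      omega
    · have : 2 + k - 1 = k + 1 := by omega
      rw [this]
      nlinarith
  have hall : ∀ l : Fin τ → ℕ, ∑ i, l i ≤ k → (∀ i, l i = k - 1) → False := by
    intro l hl h
    simp only [h, Finset.sum_const, Finset.card_univ, Fintype.card_fin, smul_eq_mul] at hl
    omega
  have hbig : ∀ l : Fin τ → ℕ, ∑ i, l i ≤ k → ∀ i, k ≤ l i → l = Pi.single i k := by
    intro l hl i hi
    rw [← Finset.add_sum_erase _ _ (Finset.mem_univ i)] at hl
    have h0 : ∑ j ∈ Finset.univ.erase i, l j = 0 := by omega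
    ext j
    rcases eq_or_ne j i with rfl | hj
    · rw [Pi.single_eq_same]; omega
    · rw [Pi.single_eq_of_ne hj]
      exact Finset.sum_eq_zero_iff.1 h0 j (Finset.mem_erase.2 ⟨hj, Finset.mem_univ j⟩)
  have hbig' : ∀ l : Fin τ → ℕ, Antitone l → ∑ i, l i ≤ k → ∀ i, k ≤ l i →
      l = Pi.single ⟨0, by omega⟩ k := by
    intro l hanti hl i hi
    exact hbig l hl _ (hi.trans (hanti (Fin.mk_le_of_le_val (Nat.zero_le _))))
  refine Nat.card_le_card_of_injective
    (fun l => (⟨(List.ofFn (φ l.1) : Multiset (Fin k)), by simp⟩ : Sym (Fin k) τ)) ?_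
  rintro ⟨l, hl, hlk⟩ ⟨l', hl', hlk'⟩ h
  have heq : φ l = φ l' := ofFn_coe_injective (hφanti l hl) (hφanti l' hl') (congrArg Subtype.val h)
  ext1
  simp only [hφ] at heq
  split_ifs at heq with h1 h2 h2
  · exact funext fun i => congrArg Fin.val (congrFun heq i)
  · exact (hall l hlk fun i => congrArg Fin.val (congrFun heq i)).elim
  · exact (hall l' hlk' fun i => (congrArg Fin.val (congrFun heq i)).symm).elim
  · push Not at h1 h2
    obtain ⟨i, hi⟩ := h1
    obtain ⟨j, hj⟩ := h2
    exact (hbig' l hl hlk i hi).trans (hbig' l' hl' hlk' j hj).symm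

lemma IsAdmissible.schurCount_le {N : ℕ} (h : IsAdmissible τ k N) : schurCount τ k ≤ N := by
  rcases h with rfl | ⟨rfl, h1, h2, h3⟩
  · exact le_rfl
  · exact schurCount_le_choose h1 h2 h3

/-- The space of symmetric polynomials of degree at most `k`. -/
noncomputable def symmetricLE (τ k : ℕ) : Submodule ℝ (MvPolynomial (Fin τ) ℝ) :=
  (MvPolynomial.symmetricSubalgebra (Fin τ) ℝ).toSubmodule ⊓
    MvPolynomial.restrictTotalDegree (Fin τ) ℝ k

lemma mem_symmetricLE {s : MvPolynomial (Fin τ) ℝ} :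
    s ∈ symmetricLE τ k ↔ s.IsSymmetric ∧ s.totalDegree ≤ k := by
  rw [symmetricLE, Submodule.mem_inf, MvPolynomial.mem_restrictTotalDegree]
  rfl

instance finiteDimensional_symmetricLE (τ k : ℕ) : FiniteDimensional ℝ (symmetricLE τ k) :=
  Submodule.finiteDimensional_inf_right _ _

/-- A symmetric polynomial of degree at most `k` is determined by its coefficients at partitions of
integers at most `k`. -/
lemma finrank_symmetricLE_le (τ k : ℕ) : Module.finrank ℝ (symmetricLE τ k) ≤ schurCount τ k := by
  have := Fintype.ofFinite {l : Fin τ → ℕ // Antitone l ∧ ∑ i, l i ≤ k}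
  set Λ := {l : Fin τ → ℕ // Antitone l ∧ ∑ i, l i ≤ k}
  set T : symmetricLE τ k →ₗ[ℝ] (Λ → ℝ) :=
    (LinearMap.pi fun l : Λ => MvPolynomial.lcoeff ℝ (Finsupp.equivFunOnFinite.symm l.1)) ∘ₗ
      (symmetricLE τ k).subtype with hT
  have hinj : Function.Injective T := by
    rw [← LinearMap.ker_eq_bot, LinearMap.ker_eq_bot']
    rintro ⟨s, hs⟩ h0
    obtain ⟨hsymm, hdeg⟩ := mem_symmetricLE.1 hs
    ext e
    simp only [ZeroMemClass.coe_zero, MvPolynomial.coeff_zero]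
    by_cases hsum : ∑ i, e i ≤ k
    -- Sorting the exponent into a partition leaves the coefficient unchanged by symmetry.
    · set σ := Tuple.sort (OrderDual.toDual ∘ e)
      have hanti : Antitone (e ∘ σ) := fun i j hij => Tuple.monotone_sort (OrderDual.toDual ∘ e) hij
      have h1 := congrFun h0 ⟨e ∘ σ, hanti, by
        simpa using (Equiv.sum_comp σ fun i => e i).trans_le hsum⟩
      have h2 := MvPolynomial.coeff_rename_mapDomain σ.symm σ.symm.injective s e
      rw [hsymm] at h2
      rw [← h2, ← show MvPolynomial.coeff (Finsupp.equivFunOnFinite.symm (e ∘ σ)) s = 0 from h1]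
      congr 1
      ext i
      rw [Finsupp.mapDomain_equiv_apply]
      rfl
    · refine MvPolynomial.coeff_eq_zero_of_totalDegree_lt (hdeg.trans_lt (not_le.1 hsum |>.trans_eq
        ?_))
      exact (Finset.sum_subset (Finset.subset_univ _) fun i _ hi => by simpa using hi).symm
  refine (LinearMap.finrank_le_finrank_of_injective hinj).trans_eq ?_
  rw [Module.finrank_fintype_fun_eq_card, schurCount, Nat.card_eq_fintype_card]

end Count

/-! ### Polynomial functions and their jets. -/

section Polynomial

open MvPolynomial

lemma totalDegree_bind₁_le {d τ m : ℕ} (p : Fin τ → MvPolynomial (Fin d) ℝ)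
    (hp : ∀ i, (p i).totalDegree ≤ m) (s : MvPolynomial (Fin τ) ℝ) :
    (bind₁ p s).totalDegree ≤ s.totalDegree * m := by
  rw [bind₁, aeval_def, eval₂_eq']
  refine totalDegree_finsetSum_le fun e he => (totalDegree_mul _ _).trans ?_
  rw [algebraMap_eq, totalDegree_C, zero_add]
  refine (totalDegree_finsetProd _ _).trans ?_
  calc ∑ i, (p i ^ e i).totalDegree ≤ ∑ i, e i * m := Finset.sum_le_sum fun i _ =>
        (totalDegree_pow _ _).trans (Nat.mul_le_mul_left _ (hp i))
    _ = (∑ i, e i) * m := (Finset.sum_mul _ _ _).symm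
    _ ≤ _ := Nat.mul_le_mul_right _ (by
        have := le_totalDegree he
        rwa [Finsupp.sum_fintype _ _ fun _ => rfl] at this)

lemma analyticOnNhd_eval {d : ℕ} (P : MvPolynomial (Fin d) ℝ) (V : Set (E d)) :
    AnalyticOnNhd ℝ (fun y : E d => eval (fun j => y j) P) V := by
  have := AnalyticOnNhd.aeval_mvPolynomial (𝕜 := ℝ) (s := V) (A := ℝ) (B := ℝ)
    (f := fun (y : E d) j => y j) (fun j => (EuclideanSpace.proj (𝕜 := ℝ) j).analyticOnNhd V) P
  exact this

/-- A polynomial of degree at most `m` whose derivatives of order at most `m` vanish at a point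
is zero as a function. -/
lemma eval_eq_zero_of_jet_eq_zero {d m : ℕ} (P : MvPolynomial (Fin d) ℝ)
    (hP : P.totalDegree ≤ m) (x : E d)
    (hx : ∀ j ≤ m, iteratedFDeriv ℝ j (fun y : E d => eval (fun j => y j) P) x = 0) (y : E d) :
    eval (fun j => y j) P = 0 := by
  set g : E d → ℝ := fun y => eval (fun j => y j) P with hg
  set v : E d := y - x with hv
  -- `Q` is `P` restricted to the line from `x` through `y`; its coefficients are directional
  -- derivatives at `x` divided by factorials, and its degree is at most `m`.
  set Q : Polynomial ℝ :=
    aeval (fun j => Polynomial.C (x j) + Polynomial.X * Polynomial.C (v j)) P with hQ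
  have hQeval : ∀ t, Q.eval t = g (x + t • v) := fun t => by
    rw [hQ, ← Polynomial.coe_evalRingHom, aeval_def, hom_eval₂, hg]
    simp only [eval, coe_eval₂Hom]
    congr 1
    · ext; simp
    · ext j
      simp only [Polynomial.coe_evalRingHom, Polynomial.eval_add,
        Polynomial.eval_C, Polynomial.eval_mul, Polynomial.eval_X, PiLp.add_apply,
        PiLp.smul_apply, smul_eq_mul]
  have hder : ∀ i t, (Polynomial.derivative^[i] Q).eval t =
      iteratedFDeriv ℝ i g (x + t • v) fun _ => v := by
    intro i
    induction i with
    | zero => intro t; simpa using hQeval t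
    | succ i ih =>
      intro t
      rw [Function.iterate_succ_apply']
      refine HasDerivAt.unique ((Polynomial.derivative^[i] Q).hasDerivAt t) ?_
      rw [show (fun t => (Polynomial.derivative^[i] Q).eval t) = _ from funext ih]
      exact hasDerivAt_iteratedFDeriv_line i (differentiableAt_iteratedFDeriv isOpen_univ
        (analyticOnNhd_eval P univ) i (mem_univ _))
  have hdeg : Q.natDegree ≤ m := by
    have := aeval_natDegree_le P hP
      (fun j => Polynomial.C (x j) + Polynomial.X * Polynomial.C (v j)) (n := 1) fun j => by
        compute_degree
    rwa [mul_one] at this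
  have hQ0 : Q = 0 := by
    ext i
    rw [Polynomial.coeff_zero]
    by_cases hi : i ≤ m
    · have h1 := hder i 0
      rw [zero_smul, add_zero, hx i hi, ← Polynomial.coeff_zero_eq_eval_zero,
        Polynomial.coeff_iterate_derivative] at h1
      simpa [Nat.descFactorial_self, Nat.factorial_ne_zero] using h1
    · exact Polynomial.coeff_eq_zero_of_natDegree_lt (by omega)
  have := hQeval 1
  rw [hQ0, hv] at this
  simpa using this.symm

end Polynomial

/-! ### From sublevel estimates to good functions. -/

section Good

variable {d : ℕ} {ν : Measure (E d)}

lemma supNorm_le {g : E d → ℝ} {B : Set (E d)} {c : ℝ} (h : ∀ z ∈ B, |g z| ≤ c) :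
    supNorm ν g B ≤ ENNReal.ofReal c :=
  iSup₂_le fun z hz => ENNReal.ofReal_le_ofReal (h z hz.1)

/-- Passes from the tame size `Γ` to the supremum in the definition of good functions; since that
supremum is at most `K * Γ`, the constant grows by `K ^ α`. -/
lemma le_rpow_div_supNorm {g : E d → ℝ} {B : Set (E d)} {C K α Γ ε : ℝ} {m b : ℝ≥0∞} (hK : 0 < K)
    (hΓ : 0 < Γ) (hε : 0 < ε) (hα : 0 < α) (hC : 0 < C) (hsup : ∀ z ∈ B, |g z| ≤ K * Γ)
    (hm : m ≤ ENNReal.ofReal (C * (ε / Γ) ^ α) * b) :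
    m ≤ ENNReal.ofReal (C * K ^ α) * (ENNReal.ofReal ε / supNorm ν g B) ^ α * b := by
  refine hm.trans ?_
  gcongr
  have h1 : C * (ε / Γ) ^ α = C * K ^ α * (ε / (K * Γ)) ^ α := by
    rw [mul_assoc, ← Real.mul_rpow (by positivity) (by positivity)]
    congr 2
    field_simp
  rw [h1, ENNReal.ofReal_mul (by positivity), ← ENNReal.ofReal_rpow_of_pos (by positivity),
    ENNReal.ofReal_div_of_pos (by positivity)]
  gcongr
  exact supNorm_le hsup

lemma le_mul_of_supNorm_eq_zero {g : E d → ℝ} {B S : Set (E d)} {C α ε : ℝ} (hε : 0 < ε)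
    (hα : 0 < α) (hC : 0 < C) (hS : S ⊆ B) (hsup : supNorm ν g B = 0) :
    ν S ≤ ENNReal.ofReal C * (ENNReal.ofReal ε / supNorm ν g B) ^ α * ν B := by
  rw [hsup, ENNReal.div_zero (by simpa using hε), ENNReal.top_rpow_of_pos hα,
    ENNReal.mul_top (by simpa using hC)]
  rcases eq_or_ne (ν B) 0 with h | h
  · rw [measure_mono_null hS h]
    exact zero_le
  · rw [ENNReal.top_mul h]
    exact le_top

lemma IsGoodOn.congr {C α : ℝ} {f g : E d → ℝ} {V : Set (E d)} (h : IsGoodOn ν C α f V)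
    (hV : IsOpen V) (hfg : EqOn f g V) : IsGoodOn ν C α g V := by
  obtain ⟨hC, hα, hm, hb⟩ := h
  refine ⟨hC, hα, hm.congr ?_, fun x r hx hr hB ε hε => ?_⟩
  · exact (ae_restrict_iff' hV.measurableSet).2 (Filter.Eventually.of_forall hfg)
  · have h1 : {y ∈ ball x r | |g y| < ε} = {y ∈ ball x r | |f y| < ε} := by
      ext y
      refine and_congr_right fun hy => ?_
      rw [hfg (hB hy)]
    have h2 : supNorm ν g (ball x r) = supNorm ν f (ball x r) :=
      iSup_congr fun y => iSup_congr fun hy => by rw [hfg (hB hy.1)]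
    rw [h1, h2]
    exact hb x r hx hr hB ε hε

/-- Lowering the exponent helps when `ε / sup ≤ 1`; otherwise a constant at least `1` makes the
bound trivial. -/
lemma IsGoodOn.mono_exponent {C α α' : ℝ} {f : E d → ℝ} {V : Set (E d)} (h : IsGoodOn ν C α f V)
    (hα' : 0 < α') (hle : α' ≤ α) : IsGoodOn ν (max C 1) α' f V := by
  obtain ⟨hC, hα, hm, hb⟩ := h
  refine ⟨lt_max_of_lt_left hC, hα', hm, fun x r hx hr hB ε hε => ?_⟩
  rcases le_or_gt (ENNReal.ofReal ε / supNorm ν f (ball x r)) 1 with h1 | h1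
  · refine (hb x r hx hr hB ε hε).trans ?_
    gcongr ENNReal.ofReal ?_ * ?_ * _
    · exact le_max_left _ _
    · exact ENNReal.rpow_le_rpow_of_exponent_ge h1 hle
  · refine (measure_mono fun y hy => hy.1).trans (le_mul_of_one_le_left zero_le ?_)
    refine one_le_mul_of_one_le_of_one_le ?_ (ENNReal.one_le_rpow h1.le hα')
    rw [ENNReal.one_le_ofReal]
    exact le_max_right _ _

lemma SymGoodNear.mono_exponent {τ k : ℕ} {U : Set (E d)} {f : E d → Fin τ → ℝ} {α α' : ℝ}
    {x : E d} (h : SymGoodNear ν U f k α x) (hα' : 0 < α') (hle : α' ≤ α) :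
    SymGoodNear ν U f k α' x := by
  obtain ⟨V, C, hV, hx, hVU, hs⟩ := h
  exact ⟨V, max C 1, hV, hx, hVU, fun s h1 h2 => (hs s h1 h2).mono_exponent hα' hle⟩

/-- A diameter of the inner ball fits in the outer one; this fails in dimension `0`, where every
ball is a point. -/
lemma radius_le_of_ball_subset_ball (hd : 0 < d) {x y : E d} {r R : ℝ} (hr : 0 < r)
    (h : ball y r ⊆ ball x R) : r ≤ R := by
  refine le_of_forall_lt fun t ht => ?_
  rcases lt_or_ge t 0 with ht0 | ht0
  · exact ht0.trans (pos_of_mem_ball (h (mem_ball_self hr)))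
  set v : E d := EuclideanSpace.single ⟨0, hd⟩ (1 : ℝ)
  have hv : ‖t • v‖ = t := by simp [v, norm_smul, abs_of_nonneg ht0]
  have h1 : dist (y + t • v) x < R := h (by rw [mem_ball, dist_self_add_left, hv]; exact ht)
  have h2 : dist (y - t • v) x < R := h (by rw [mem_ball, dist_self_sub_left, hv]; exact ht)
  have h3 : dist (y + t • v) (y - t • v) = 2 * t := by
    rw [dist_eq_norm, show y + t • v - (y - t • v) = (2 : ℝ) • (t • v) by module, norm_smul, hv]
    simp
  have h4 := dist_triangle_right (y + t • v) (y - t • v) x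
  linarith

lemma IsTame.abs_le {l : ℕ} {K r Γ : ℝ} {g : E d → ℝ} {y : E d} (h : IsTame l K g y r Γ)
    {z : E d} (hz : z ∈ ball y r) : |g z| ≤ K * Γ := by
  simpa using h.upper z hz 0 (Nat.zero_le _)

section Family

variable {l : ℕ} {V : Set (E d)} {F : Submodule ℝ (E d → ℝ)} [FiniteDimensional ℝ F] {x₀ : E d}

/-- Functions in a finite-dimensional space of analytic functions whose jets at `x₀` are injective
are uniformly good near `x₀` with respect to absolutely decaying doubling measures. -/
theorem exists_isGoodOn_of_absDecaying (hd : 0 < d) (hl : 0 < l) (hV : IsOpen V)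
    (hF : ∀ g ∈ F, AnalyticOnNhd ℝ g V) (hx₀ : x₀ ∈ V)
    (hjet : ∀ g ∈ F, (∀ j ≤ l, iteratedFDeriv ℝ j g x₀ = 0) → g = 0) {C₀ α₀ : ℝ} {U : Set (E d)}
    (hU : IsOpen U) (hxU : x₀ ∈ U) (hdec : IsAbsDecayingOn ν C₀ α₀ U) (hfed : IsFedererAt ν x₀) :
    ∃ R C : ℝ, 0 < R ∧ ball x₀ R ⊆ V ∧
      ∀ g ∈ F, IsGoodOn ν C (α₀ / (2 ^ (l + 1) - 2)) g (ball x₀ R) := by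
  obtain ⟨V', D, hV', hxV', hfed⟩ := hfed
  obtain ⟨R, K, hR, hR1, hK, hRV, htame⟩ := exists_isTame hV F hF hx₀ hjet
  obtain ⟨R', hR', hRUV⟩ := Metric.isOpen_iff.1 (hU.inter hV') x₀ ⟨hxU, hxV'⟩
  have hC₀ := hdec.1
  have hα₀ := hdec.2.1
  have hD := hfed.1
  set α : ℝ := α₀ / (2 ^ (l + 1) - 2) with hα
  have hα0 : 0 < α := by
    have : (2 : ℝ) ^ 1 < 2 ^ (l + 1) := pow_lt_pow_right₀ one_lt_two (by omega)
    exact div_pos hα₀ (by linarith)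
  set C₁ : ℝ := l * (C₀ * (2 * (2 + K)) ^ α₀ * D ^ 2) + 1 with hC₁
  have hC₁0 : 0 < C₁ := by positivity
  -- A ball of radius `r` inside `ball x₀ ρ` has `r ≤ ρ`, so its threefold enlargement stays within
  -- `4 * ρ ≤ R'` of `x₀`, where both decay and doubling are available.
  set ρ := min R (R' / 4) with hρ
  have hρ0 : 0 < ρ := lt_min hR (by positivity)
  have hρR : ρ ≤ R := min_le_left _ _
  have hρR' : ρ ≤ R' / 4 := min_le_right _ _
  refine ⟨ρ, C₁ * K ^ α, hρ0, (ball_subset_ball hρR).trans hRV, fun g hg => ?_⟩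
  have hgan : AnalyticOnNhd ℝ g (ball x₀ ρ) :=
    (hF g hg).mono ((ball_subset_ball hρR).trans hRV)
  refine ⟨by positivity, hα0, hgan.continuousOn.aemeasurable measurableSet_ball,
    fun y r hy hr hB ε hε => ?_⟩
  rcases eq_or_ne g 0 with rfl | hg0
  · exact le_mul_of_supNorm_eq_zero hε hα0 (by positivity) (fun w hw => hw.1)
      (by simp [supNorm])
  have hrρ := radius_le_of_ball_subset_ball hd hr hB
  obtain ⟨Γ, hΓ, ht⟩ := htame g hg hg0 y r hr (by linarith)
    (hB.trans (ball_subset_ball hρR))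
  have hbig : ball y (3 * r) ⊆ U ∩ V' := by
    refine (ball_subset_ball' ?_).trans hRUV
    have := mem_ball.1 (hB (mem_ball_self hr))
    linarith
  refine le_rpow_div_supNorm hK hΓ hε hα0 hC₁0 (fun z hz => ht.abs_le hz) ?_
  rcases le_or_gt ε Γ with hεΓ | hεΓ
  · refine (ht.measure_sublevel_le hdec hfed hK.le hy hr (hbig.trans inter_subset_left)
      (hbig.trans inter_subset_right) hΓ hε hεΓ hl).trans ?_
    gcongr
    linarith
  · refine (measure_mono fun w hw => hw.1).trans (le_mul_of_one_le_left zero_le ?_)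
    rw [ENNReal.one_le_ofReal]
    have h1 : 1 ≤ (ε / Γ) ^ α := Real.one_le_rpow ((one_le_div hΓ).2 hεΓ.le) hα0.le
    have h2 : 1 ≤ C₁ := le_add_of_nonneg_left (by positivity)
    nlinarith

/-- Functions in a finite-dimensional space of analytic functions whose jets at `x₀` are injective
are uniformly good near `x₀` with respect to Lebesgue measure. -/
theorem exists_isGoodOn_volume (hd : 0 < d) (hl : 0 < l) (hV : IsOpen V)
    (hF : ∀ g ∈ F, AnalyticOnNhd ℝ g V) (hx₀ : x₀ ∈ V)
    (hjet : ∀ g ∈ F, (∀ j ≤ l, iteratedFDeriv ℝ j g x₀ = 0) → g = 0) :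
    ∃ R C : ℝ, 0 < R ∧ ball x₀ R ⊆ V ∧
      ∀ g ∈ F, IsGoodOn volume C (1 / l : ℝ) g (ball x₀ R) := by
  obtain ⟨R, K, hR, hR1, hK, hRV, htame⟩ := exists_isTame hV F hF hx₀ hjet
  obtain ⟨C₁, hC₁0, hC₁⟩ := IsTame.volume_sublevel_le d hl hK.le
  have hl0 : (0 : ℝ) < l := by exact_mod_cast hl
  have hα0 : (0 : ℝ) < 1 / l := by positivity
  refine ⟨R, C₁ * K ^ (1 / l : ℝ), hR, hRV, fun g hg => ⟨by positivity, hα0,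
    ((hF g hg).mono hRV).continuousOn.aemeasurable measurableSet_ball,
    fun y r hy hr hB ε hε => ?_⟩⟩
  rcases eq_or_ne g 0 with rfl | hg0
  · exact le_mul_of_supNorm_eq_zero hε hα0 (by positivity) (fun w hw => hw.1)
      (by simp [supNorm])
  have hrR := radius_le_of_ball_subset_ball hd hr hB
  obtain ⟨Γ, hΓ, ht⟩ := htame g hg hg0 y r hr (by linarith) hB
  exact le_rpow_div_supNorm hK hΓ hε hα0 hC₁0 (fun z hz => ht.abs_le hz)
    (hC₁ g y r Γ ε ht hr hΓ hε)

end Family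

end Good

/-! ### Application to symmetric polynomials. -/

section Main

variable {d τ k : ℕ}

/-- The space of the functions `s(f)` on `V`, extended by zero, for symmetric polynomials `s` of
degree at most `k`. -/
noncomputable def symmetricEval (f : E d → Fin τ → ℝ) (k : ℕ) (V : Set (E d)) :
    symmetricLE τ k →ₗ[ℝ] (E d → ℝ) where
  -- Extension by zero makes a function of the range that vanishes on `V` equal to zero, so jets at
  -- points of `V` can determine it.
  toFun s := V.indicator fun y => MvPolynomial.eval (f y) s.1
  map_add' s t := by
    ext y
    by_cases hy : y ∈ V <;> simp [hy]
  map_smul' c s := by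
    ext y
    by_cases hy : y ∈ V <;> simp [hy]

lemma analyticOnNhd_symmetricEval {f : E d → Fin τ → ℝ} {V : Set (E d)} (hV : IsOpen V)
    (hf : AnalyticOnNhd ℝ f V) (s : symmetricLE τ k) :
    AnalyticOnNhd ℝ (symmetricEval f k V s) V := by
  have h : AnalyticOnNhd ℝ (fun y => MvPolynomial.eval (f y) s.1) V :=
    AnalyticOnNhd.aeval_mvPolynomial (A := ℝ) (fun i x hx => analyticAt_pi_iff.1 (hf x hx) i) s.1
  refine h.congr hV fun y hy => ?_
  simp [symmetricEval, hy]

/-- Near a generic point of `V`, the jets of order less than the number of Schur polynomials are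
injective on the functions `s(f)`. -/
lemma exists_generic_symmetricEval {f : E d → Fin τ → ℝ} {V : Set (E d)} (hV : IsOpen V)
    (hpre : IsPreconnected V) (hne : V.Nonempty) (hf : AnalyticOnNhd ℝ f V) :
    ∃ W : E d → ℝ, AnalyticOnNhd ℝ W V ∧ (∃ x ∈ V, W x ≠ 0) ∧ ∀ x ∈ V, W x ≠ 0 →
      ∀ g ∈ LinearMap.range (symmetricEval f k V),
        (∀ j < schurCount τ k, iteratedFDeriv ℝ j g x = 0) → g = 0 := by
  obtain ⟨W, hW, hW0, hWg⟩ := exists_generic_jet_injective hV hpre hne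
    (LinearMap.range (symmetricEval f k V)) (by
      rintro _ ⟨s, rfl⟩
      exact analyticOnNhd_symmetricEval hV hf s) (by
      rintro _ ⟨s, rfl⟩ h
      ext y
      by_cases hy : y ∈ V
      · exact h y hy
      · simp [symmetricEval, hy])
  refine ⟨W, hW, hW0, fun x hx hWx g hg hj => hWg x hx hWx g hg fun j hjF => hj j ?_⟩
  exact hjF.trans_le ((LinearMap.finrank_range_le _).trans (finrank_symmetricLE_le τ k))

lemma symGoodNear_of_family {ν : Measure (E d)} {f : E d → Fin τ → ℝ} {U V : Set (E d)}
    {F : Submodule ℝ (E d → ℝ)} {α : ℝ} {x : E d} (hVU : V ⊆ U)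
    (hsF : ∀ s : MvPolynomial (Fin τ) ℝ, s.IsSymmetric → s.totalDegree ≤ k →
      ∃ g ∈ F, EqOn g (fun y => MvPolynomial.eval (f y) s) V)
    (h : ∃ R C : ℝ, 0 < R ∧ ball x R ⊆ V ∧ ∀ g ∈ F, IsGoodOn ν C α g (ball x R)) :
    SymGoodNear ν U f k α x := by
  obtain ⟨R, C, hR, hRV, hgood⟩ := h
  refine ⟨ball x R, C, isOpen_ball, mem_ball_self hR, hRV.trans hVU, fun s hs hsk => ?_⟩
  obtain ⟨g, hg, hgs⟩ := hsF s hs hsk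
  exact (hgood g hg).congr isOpen_ball (hgs.mono hRV)

/-- No genericity is needed: every `s(f)` agrees on `U` with a polynomial of degree at most `m = k
deg f`, and a polynomial of that degree is determined by its `m`-jet at any point. -/
theorem symGoodNear_of_polynomial (hd : 0 < d) (hk : 0 < k) {U : Set (E d)} (hU : IsOpen U)
    {f : E d → Fin τ → ℝ} (p : Fin τ → MvPolynomial (Fin d) ℝ) (hp : 0 < mapDegree p)
    (hfp : ∀ y ∈ U, ∀ i, f y i = MvPolynomial.eval (fun j => y j) (p i)) {x : E d} (hx : x ∈ U) :
    SymGoodNear volume U f k (1 / (k * (mapDegree p : ℝ))) x := by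
  set m := k * mapDegree p with hm
  set T : MvPolynomial.restrictTotalDegree (Fin d) ℝ m →ₗ[ℝ] (E d → ℝ) :=
    { toFun := fun P y => MvPolynomial.eval (fun j => y j) P.1
      map_add' := fun P Q => by ext y; simp
      map_smul' := fun c P => by ext y; simp } with hT
  have hjet : ∀ g ∈ LinearMap.range T, (∀ j ≤ m, iteratedFDeriv ℝ j g x = 0) → g = 0 := by
    rintro _ ⟨P, rfl⟩ hj
    ext y
    exact eval_eq_zero_of_jet_eq_zero P.1 ((MvPolynomial.mem_restrictTotalDegree _ _ _).1 P.2) x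
      hj y
  have hgood := exists_isGoodOn_volume (l := m) hd (Nat.mul_pos hk hp) hU (by
    rintro _ ⟨P, rfl⟩
    exact analyticOnNhd_eval P.1 U) hx hjet
  rw [← Nat.cast_mul, ← hm]
  refine symGoodNear_of_family subset_rfl (fun s _ hsk => ⟨T ⟨MvPolynomial.bind₁ p s, ?_⟩,
    LinearMap.mem_range_self T _, fun y hy => ?_⟩) hgood
  · rw [MvPolynomial.mem_restrictTotalDegree]
    exact (totalDegree_bind₁_le p (fun i => Finset.le_sup (f := fun i => (p i).totalDegree)
      (Finset.mem_univ i)) s).trans (Nat.mul_le_mul_right _ hsk)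
  · have h1 : f y = fun i => MvPolynomial.eval (fun j => y j) (p i) := funext (hfp y hy)
    change MvPolynomial.eval (fun j => y j) (MvPolynomial.bind₁ p s) =
      MvPolynomial.eval (f y) s
    rw [h1, MvPolynomial.eval, MvPolynomial.eval₂Hom_bind₁]
    rfl

end Main

end SymGood

theorem mainTheorem8 (d τ k : ℕ) (hd : 0 < d) (hτ : 0 < τ) (hk : 0 < k)
    (U : Set (SymGood.E d)) (hU : IsOpen U)
    (f : SymGood.E d → Fin τ → ℝ) (hf : AnalyticOnNhd ℝ f U) :
    ∃ W : SymGood.E d → ℝ, AnalyticOnNhd ℝ W U ∧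
      (∀ x ∈ U, ∃ y ∈ connectedComponentIn U x, W y ≠ 0) ∧
      ∀ x ∈ U, W x ≠ 0 →
        (∀ N : ℕ, SymGood.IsAdmissible τ k N →
          (∀ (ν : MeasureTheory.Measure (SymGood.E d)) (C₀ α₀ : ℝ),
            SymGood.IsRadonOn ν U → SymGood.IsAbsDecayingOn ν C₀ α₀ U →
            SymGood.IsFedererAt ν x →
              SymGood.SymGoodNear ν U f k (α₀ / (2 ^ N - 2)) x) ∧
          SymGood.SymGoodNear MeasureTheory.volume U f k (1 / (d * ((N : ℝ) - 1))) x) ∧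
        (∀ p : Fin τ → MvPolynomial (Fin d) ℝ, 0 < SymGood.mapDegree p →
          (∀ y ∈ U, ∀ i, f y i = MvPolynomial.eval (fun j => y j) (p i)) →
            SymGood.SymGoodNear MeasureTheory.volume U f k
              (1 / (k * (SymGood.mapDegree p : ℝ))) x) := by
  have hcompOpen : ∀ x, IsOpen (connectedComponentIn U x) := fun x => hU.connectedComponentIn
  have hgen : ∀ V : Set (SymGood.E d), ∃ W : SymGood.E d → ℝ,
      (∃ x ∈ U, V = connectedComponentIn U x) →
      AnalyticOnNhd ℝ W V ∧ (∃ x ∈ V, W x ≠ 0) ∧ ∀ x ∈ V, W x ≠ 0 →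
        ∀ g ∈ LinearMap.range (SymGood.symmetricEval f k V),
          (∀ j < SymGood.schurCount τ k, iteratedFDeriv ℝ j g x = 0) → g = 0 := by
    intro V
    by_cases hV : ∃ x ∈ U, V = connectedComponentIn U x
    · obtain ⟨x, hx, rfl⟩ := hV
      obtain ⟨W, hW⟩ := SymGood.exists_generic_symmetricEval (k := k) (hcompOpen x)
        isPreconnected_connectedComponentIn ⟨x, mem_connectedComponentIn hx⟩
        (hf.mono (connectedComponentIn_subset U x))
      exact ⟨W, fun _ => hW⟩
    · exact ⟨0, fun h => (hV h).elim⟩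
  choose w hw using hgen
  -- `W` is glued from one Wronskian per connected component; it is analytic because components of
  -- the open set `U` are open.
  refine ⟨fun x => w (connectedComponentIn U x) x, fun x hx => ?_, fun x hx => ?_,
    fun x hx hWx => ⟨fun N hN => ?_, fun p hp hfp =>
      SymGood.symGoodNear_of_polynomial hd hk hU p hp hfp hx⟩⟩
  · refine ((hw _ ⟨x, hx, rfl⟩).1 x (mem_connectedComponentIn hx)).congr ?_
    filter_upwards [(hcompOpen x).mem_nhds (mem_connectedComponentIn hx)] with y hy
    rw [connectedComponentIn_eq hy]
  · obtain ⟨y, hy, hy0⟩ := (hw _ ⟨x, hx, rfl⟩).2.1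
    refine ⟨y, hy, ?_⟩
    change w (connectedComponentIn U y) y ≠ 0
    rwa [← connectedComponentIn_eq hy]
  have hjet := (hw _ ⟨x, hx, rfl⟩).2.2 x (mem_connectedComponentIn hx) hWx
  have hSN := hN.schurCount_le
  have h2N := (SymGood.two_le_schurCount hτ hk).trans hSN
  -- Jets of order less than `schurCount τ k ≤ N` are those of order at most `l`, which turns `2 ^
  -- (l + 1) - 2` into `2 ^ N - 2`.
  obtain ⟨l, rfl⟩ : ∃ l, N = l + 1 := ⟨N - 1, by omega⟩
  have hl : 0 < l := by omega
  set V := connectedComponentIn U x with hV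
  have hVU : V ⊆ U := connectedComponentIn_subset U x
  have hxV : x ∈ V := mem_connectedComponentIn hx
  have hF : ∀ g ∈ LinearMap.range (SymGood.symmetricEval f k V), AnalyticOnNhd ℝ g V := by
    rintro _ ⟨s, rfl⟩
    exact SymGood.analyticOnNhd_symmetricEval (hcompOpen x) (hf.mono hVU) s
  have hjet' : ∀ g ∈ LinearMap.range (SymGood.symmetricEval f k V),
      (∀ j ≤ l, iteratedFDeriv ℝ j g x = 0) → g = 0 :=
    fun g hg hj => hjet g hg fun j hjS => hj j (by omega)
  have hsF : ∀ s : MvPolynomial (Fin τ) ℝ, s.IsSymmetric → s.totalDegree ≤ k →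
      ∃ g ∈ LinearMap.range (SymGood.symmetricEval f k V),
        EqOn g (fun y => MvPolynomial.eval (f y) s) V := fun s hs hsk =>
    ⟨_, ⟨⟨s, SymGood.mem_symmetricLE.2 ⟨hs, hsk⟩⟩, rfl⟩, fun y hy => by
      simp [SymGood.symmetricEval, hy]⟩
  refine ⟨fun ν C₀ α₀ _ hdec hfed => SymGood.symGoodNear_of_family hVU hsF
    (SymGood.exists_isGoodOn_of_absDecaying hd hl (hcompOpen x) hF hxV hjet' hU hx hdec hfed), ?_⟩
  have hd1 : (1 : ℝ) ≤ d := by exact_mod_cast hd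
  have hl0 : (0 : ℝ) < l := by exact_mod_cast hl
  push_cast
  rw [add_sub_cancel_right]
  refine (SymGood.symGoodNear_of_family hVU hsF
    (SymGood.exists_isGoodOn_volume hd hl (hcompOpen x) hF hxV hjet')).mono_exponent
    (by positivity) ?_
  -- The exponent `1 / l` obtained by slicing is weakened to `1 / (d l)`.
  exact one_div_le_one_div_of_le hl0 (le_mul_of_one_le_left hl0.le hd1)
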